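/- Let $d\ge 1$, let $\mathcal X=\prod_{i=1}^d[0,a_i]\subset\mathbb R^d$ be a box, and let $\mathcal K\subseteq\mathcal X$ be a compact convex set with nonempty interior, $0\in\mathcal K$ and $\mathcal K\subseteq D\,\mathbb B_d$, where $\mathbb B_d$ is the closed Euclidean unit ball. Let $\Phi:\mathrm{int}(\mathcal K)\to\mathbb R$ be a $\nu$-self-concordant barrier of $\mathcal K$: $\Phi$ is $C^3$ and convex, tends to $+\infty$ at the boundary of $\mathcal K$, and for all $x\in\mathrm{int}(\mathcal K)$, $h\in\mathbb R^d$, $$|\nabla^3\Phi(x)[h,h,h]|\le 2(\nabla^2\Phi(x)[h,h])^{3/2},\qquad |\nabla\Phi(x)[h]|\le \nu^{1/2}(\nabla^2\Phi(x)[h,h])^{1/2}.$$ Let $T\ge 2$. An oblivious adversary fixes in advance reward functions $f_1,\dots,f_T$, each of which is multi-linear (a real polynomial in $d$ variables of degree at most $1$ in each variable), vanishes at $0$, and on $\mathcal X$ is nonnegative, monotone ($f(x)\ge f(y)$ if $x\ge y$ coordinatewise), DR-submodular ($f(x+\lambda e_i)-f(x)\le f(y+\lambda e_i)-f(y)$ whenever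 $x\ge y$ coordinatewise, $\lambda\ge 0$, $1\le i\le d$, and these points lie in $\mathcal X$) and $L_1$-Lipschitz for the Euclidean norm. Algorithm $\mathtt{BanditMLSM}(\eta,L,\Phi)$ divides the rounds into $Q=\lceil T/L\rceil$ consecutive blocks of length $L$, the last one being cut off at round $T$. It starts from the point $x_1\in\mathrm{int}(\mathcal K)$ with $\nabla\Phi(x_1)=0$. In block $q$ it draws, independently of each other and of the past, $t_q$ uniformly from $\{(q-1)L+1,\dots,qL\}$; $z_q\in[0,1]$ with density $e^{z-1}/(1-e^{-1})$; $v_q$ uniformly from the Euclidean unit sphere; and $u_q\in\{0,e_1,\dots,e_d\}$ with $\Pr(u_q=0)=\frac12$ and $\Pr(u_q=e_i)=\frac1{2d}$. Put $H_q=(\nabla^2\Phi(x_q))^{-1/2}$. In round $t_q$ it plays $y_{t_q}=z_qx_q+z_q\langle H_qv_q,u_q\rangle u_q$ and observes $f_{t_q}(y_{t_q})$; in every other round $t$ of the block it plays $y_t=x_q$. It sets $\widetilde l_q=\pm 2(1-1/e)\frac{d}{z_q}f_{t_q}(y_{t_q})$, with the sign $-$ if $u_q=0$ and $+$ if $u_q\ne0$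 (and $\widetilde l_q=0$ if $z_q=0$), sets $\widetilde g_q=d\,\widetilde l_q\,H_q^{-1}v_q$, and moves to $$x_{q+1}=\arg\min_{x\in\mathcal K}\Big(-\eta\sum_{s=1}^q\langle \widetilde g_s,x\rangle+\Phi(x)\Big),$$ where $\Phi=+\infty$ on the boundary of $\mathcal K$. Then, with $\eta=d^{-8/3}T^{-1/3}$ and $L=\lceil d^{-4/3}T^{1/3}\rceil$, almost surely every played action lies in $\mathcal X$, the rewards $f_t(y_t)$ are integrable, and the expected $(1-1/e)$-regret satisfies $$\mathcal R_{1-1/e}(T)=\max_{x^*\in\mathcal K}\mathbb E\Big[\sum_{t=1}^T\big((1-1/e)f_t(x^*)-f_t(y_t)\big)\Big]\le C\,(1+L_1D)^2\,\nu\,d^{4/3}\,T^{2/3}\log T$$ with an absolute constant $C$. In particular $\mathcal R_{1-1/e}(T)=O(\nu d^{4/3}T^{2/3}\log T)$, where the $O$ hides only a factor that depends on $L_1$ and $D$. -/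

import Mathlib

open MeasureTheory ProbabilityTheory Topology Filter

open scoped RealInnerProductSpace

/-- `ℝ^d` with the Euclidean norm. -/
abbrev Vec (d : ℕ) : Type := EuclideanSpace ℝ (Fin d)

/-- The `i`-th base vector `e_i` of `ℝ^d`. -/
noncomputable def baseVec {d : ℕ} (i : Fin d) : Vec d := EuclideanSpace.single i (1 : ℝ)

/-! ### Reward functions -/

/-- The box `∏ i, [0, a i]`, the domain of the reward functions. -/
def box {d : ℕ} (a : Fin d → ℝ) : Set (Vec d) := {x | ∀ i, 0 ≤ x i ∧ x i ≤ a i}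

/-- Monotonicity on `X` for the coordinatewise order. -/
def IsMonotoneFun {d : ℕ} (X : Set (Vec d)) (f : Vec d → ℝ) : Prop :=
  ∀ x ∈ X, ∀ y ∈ X, (∀ i, y i ≤ x i) → f y ≤ f x

/-- DR-submodularity on `X`: `f` is a continuous nonnegative function on `X` with diminishing
returns along each coordinate direction. -/
structure IsDRSubmodular {d : ℕ} (X : Set (Vec d)) (f : Vec d → ℝ) : Prop where
  continuousOn : ContinuousOn f X
  nonneg : ∀ x ∈ X, 0 ≤ f x
  diminishing : ∀ x ∈ X, ∀ y ∈ X, (∀ i, y i ≤ x i) → ∀ (i : Fin d) (r : ℝ), 0 ≤ r →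
    x + r • baseVec i ∈ X → y + r • baseVec i ∈ X →
    f (x + r • baseVec i) - f x ≤ f (y + r • baseVec i) - f y

/-- Multi-linearity: `f` is a polynomial of degree at most one in each variable. -/
def IsMultilinearFun {d : ℕ} (f : Vec d → ℝ) : Prop :=
  ∃ p : MvPolynomial (Fin d) ℝ, (∀ i, p.degreeOf i ≤ 1) ∧
    ∀ x : Vec d, f x = MvPolynomial.eval (fun i => x i) p

/-- The class of rewards: monotone multi-linear DR-submodular functions on `X` which are
`L₁`-Lipschitz on `X` for the Euclidean norm and vanish at the origin. -/
structure IsMDSReward {d : ℕ} (X : Set (Vec d)) (L₁ : ℝ) (f : Vec d → ℝ) : Prop where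
  multilinear : IsMultilinearFun f
  monotone : IsMonotoneFun X f
  drSubmodular : IsDRSubmodular X f
  lipschitz : ∀ x ∈ X, ∀ y ∈ X, |f x - f y| ≤ L₁ * ‖x - y‖
  map_zero : f 0 = 0

/-! ### Self-concordant barriers -/

/-- `Φ` is a `ν`-self-concordant barrier of `K`. Only the values of `Φ` on `interior K` matter. -/
structure IsSelfConcordantBarrier {d : ℕ} (K : Set (Vec d)) (ν : ℝ) (Φ : Vec d → ℝ) : Prop where
  nonneg : 0 ≤ ν
  convex_set : Convex ℝ K
  interior_nonempty : (interior K).Nonempty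
  contDiffOn : ContDiffOn ℝ 3 Φ (interior K)
  convexOn : ConvexOn ℝ (interior K) Φ
  tendsto_boundary : ∀ x ∈ frontier K, Tendsto Φ (𝓝[interior K] x) atTop
  third_le : ∀ x ∈ interior K, ∀ h : Vec d,
    |iteratedFDeriv ℝ 3 Φ x (fun _ => h)| ≤
      2 * (iteratedFDeriv ℝ 2 Φ x (fun _ => h)) ^ (3 / 2 : ℝ)
  first_le : ∀ x ∈ interior K, ∀ h : Vec d,
    |fderiv ℝ Φ x h| ≤ ν ^ (1 / 2 : ℝ) * (iteratedFDeriv ℝ 2 Φ x (fun _ => h)) ^ (1 / 2 : ℝ)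

/-- The Hessian matrix `∇²Φ(x)`. -/
noncomputable def hessianMatrix {d : ℕ} (Φ : Vec d → ℝ) (x : Vec d) :
    Matrix (Fin d) (Fin d) ℝ :=
  Matrix.of fun i j => iteratedFDeriv ℝ 2 Φ x ![baseVec i, baseVec j]

open scoped MatrixOrder in
/-- `H = (∇²Φ(x))^{-1/2}`, the positive square root of the inverse Hessian. -/
noncomputable def dikinMatrix {d : ℕ} (Φ : Vec d → ℝ) (x : Vec d) : Matrix (Fin d) (Fin d) ℝ :=
  CFC.sqrt (hessianMatrix Φ x)⁻¹

/-! ### The coins of one block -/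

/-- The coins `(t, z, v, u)` of one block of length `L`: the position `t` of the exploration round
inside the block, the scaling `z`, the direction `v` on the unit sphere, and the vector `u`. -/
abbrev Coins (d L : ℕ) : Type := Fin L × ℝ × Metric.sphere (0 : Vec d) 1 × Vec d

/-- The law of `z`, with density `e^{u-1} / (1 - e^{-1})` on `[0,1]`. -/
noncomputable def scaleLaw : Measure ℝ :=
  (volume.restrict (Set.Icc (0 : ℝ) 1)).withDensity
    fun u => ENNReal.ofReal (Real.exp (u - 1) / (1 - Real.exp (-1)))

/-- The uniform law on the unit sphere: the surface measure, normalized. -/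
noncomputable def sphereLaw (d : ℕ) : Measure (Metric.sphere (0 : Vec d) 1) :=
  ((volume : Measure (Vec d)).toSphere Set.univ)⁻¹ • (volume : Measure (Vec d)).toSphere

/-- The law of `u`: the value `0` has probability `1/2`, each `e_i` has probability `1/(2d)`. -/
noncomputable def directionLaw (d : ℕ) : Measure (Vec d) :=
  ENNReal.ofReal (1 / 2) • Measure.dirac 0 +
    ∑ i : Fin d, ENNReal.ofReal (1 / (2 * (d : ℝ))) • Measure.dirac (baseVec i)

/-- The joint law of the coins of one block: `t` (uniform), `z`, `v`, `u` are independent. -/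
noncomputable def coinLaw (d L : ℕ) : Measure (Coins d L) :=
  (uniformOn (Set.univ : Set (Fin L))).prod
    (scaleLaw.prod ((sphereLaw d).prod (directionLaw d)))

/-! ### The algorithm `BanditMLSM` -/

namespace BanditMLSM

/-- The RFTL point: the minimizer over `K` of `-η ⟨G, x⟩ + Φ(x)`, where `Φ` is `+∞` on the boundary
of `K`. For `G = 0` it is the point of `interior K` with `∇Φ = 0`. -/
noncomputable def rftlPoint {d : ℕ} (K : Set (Vec d)) (Φ : Vec d → ℝ) (η : ℝ) (G : Vec d) :
    Vec d :=
  Classical.epsilon fun x => x ∈ interior K ∧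
    ∀ y ∈ interior K, -(η * ⟪G, x⟫) + Φ x ≤ -(η * ⟪G, y⟫) + Φ y

/-- `H v`, with `H = (∇²Φ(x))^{-1/2}` and `v` the sampled direction. -/
noncomputable def dikinStep {d L : ℕ} (Φ : Vec d → ℝ) (x : Vec d) (c : Coins d L) : Vec d :=
  Matrix.toEuclideanLin (dikinMatrix Φ x) c.2.2.1

/-- The action `z x + z ⟨H v, u⟩ u` played in the exploration round of a block. -/
noncomputable def exploreAction {d L : ℕ} (Φ : Vec d → ℝ) (x : Vec d) (c : Coins d L) : Vec d :=
  c.2.1 • x + (c.2.1 * ⟪dikinStep Φ x c, c.2.2.2⟫) • c.2.2.2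

open Classical in
/-- The estimate `l̃(H v)` computed from the feedback `r` of the exploration round. -/
noncomputable def linearEstimate {d L : ℕ} (c : Coins d L) (r : ℝ) : ℝ :=
  if c.2.1 = 0 then 0
  else if c.2.2.2 = 0 then -(2 * (1 - 1 / Real.exp 1) * (d / c.2.1) * r)
  else 2 * (1 - 1 / Real.exp 1) * (d / c.2.1) * r

/-- The one-point gradient estimate `d · l̃(H v) · H⁻¹ v`, computed from the feedback `r`. -/
noncomputable def gradEstimate {d L : ℕ} (Φ : Vec d → ℝ) (x : Vec d) (c : Coins d L) (r : ℝ) :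
    Vec d :=
  ((d : ℝ) * linearEstimate c r) • Matrix.toEuclideanLin (dikinMatrix Φ x)⁻¹ c.2.2.1

/-- The sum of the gradient estimates of the first `q` blocks. Rounds and blocks are numbered from
`0`, block `q` consists of the rounds `q L, …, q L + L - 1`, and `c q` are the coins of block `q`.
Of the rewards, only the observed values (the played action in the exploration rounds) are used. -/
noncomputable def gradSum {d L : ℕ} (K : Set (Vec d)) (Φ : Vec d → ℝ) (η : ℝ)
    (f : ℕ → Vec d → ℝ) (c : ℕ → Coins d L) : ℕ → Vec d
  | 0 => 0
  | q + 1 =>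
    gradSum K Φ η f c q +
      gradEstimate Φ (rftlPoint K Φ η (gradSum K Φ η f c q)) (c q)
        (f (q * L + (c q).1)
          (exploreAction Φ (rftlPoint K Φ η (gradSum K Φ η f c q)) (c q)))

/-- The point `x_q` used in block `q`. -/
noncomputable def iterate {d L : ℕ} (K : Set (Vec d)) (Φ : Vec d → ℝ) (η : ℝ)
    (f : ℕ → Vec d → ℝ) (c : ℕ → Coins d L) (q : ℕ) : Vec d :=
  rftlPoint K Φ η (gradSum K Φ η f c q)

/-- The action `y_t` played in round `t`, which is round `t % L` of block `t / L`. It depends on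
the rewards of earlier rounds only. -/
noncomputable def action {d L : ℕ} (K : Set (Vec d)) (Φ : Vec d → ℝ) (η : ℝ)
    (f : ℕ → Vec d → ℝ) (c : ℕ → Coins d L) (t : ℕ) : Vec d :=
  if t % L = (c (t / L)).1 then exploreAction Φ (iterate K Φ η f c (t / L)) (c (t / L))
  else iterate K Φ η f c (t / L)

end BanditMLSM

/-- The expected `α`-regret, after `T` rounds, of the random actions `y` against the fixed
comparator `x`. The expected `α`-regret is its maximum over `x`. -/
noncomputable def regretAgainst {d : ℕ} {Ω : Type*} [MeasurableSpace Ω] (P : Measure Ω) (α : ℝ)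
    (T : ℕ) (f : ℕ → Vec d → ℝ) (y : ℕ → Ω → Vec d) (x : Vec d) : ℝ :=
  ∫ ω, ∑ t ∈ Finset.range T, (α * f t x - f t (y t ω)) ∂P

/-- `R` is the expected `α`-regret `max_{x ∈ K} E[∑_{t < T} (α f_t(x) - f_t(y_t))]`. -/
def IsExpectedRegret {d : ℕ} {Ω : Type*} [MeasurableSpace Ω] (P : Measure Ω) (K : Set (Vec d))
    (α : ℝ) (T : ℕ) (f : ℕ → Vec d → ℝ) (y : ℕ → Ω → Vec d) (R : ℝ) : Prop :=
  IsGreatest (regretAgainst P α T f y '' K) R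

/-!
The algorithm runs regularized follow-the-leader on linear rewards `⟨g̃_q, ·⟩`, one for each block,
whose expectations dominate the regret of the block. Three facts carry the argument.

*Boosting* (`IsMDSReward.boosting`). For a monotone DR-submodular `f` with `f 0 = 0`, the average
`∫₀¹ e^{z-1} ∇f(zx) dz` satisfies `(1 - 1/e) f(y) - f(x) ≤ ⟨∫₀¹ e^{z-1} ∇f(zx) dz, y - x⟩`: by
diminishing returns and monotonicity `⟨∇f(zx), y⟩ ≥ f(y) - f(zx)`, while `⟨∇f(zx), x⟩` is a
derivative in `z` and can be integrated by parts.

*Unbiasedness* (`BanditMLSM.integral_inner_gradEstimate`). A multi-linear function is affine along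
each coordinate direction, so finite differences at the distance of a Dikin step are exact partial
derivatives, and averaging over `u` yields `⟨∇f(zx), Hv⟩` without a smoothing error. The second
moments of the uniform law on the sphere (`integral_inner_mul_inner`) turn this into `∇f(zx)`, and
the law of `z` supplies the weight `e^{z-1}`. Since `f(y) ≤ L₁ ‖y‖` is of order `z` at the played
action, the division by `z` costs nothing: the dual local norm of the estimate is at most
`b = 4 d² L₁ D` whatever the current point (`BanditMLSM.abs_inner_gradEstimate_le`).

*Self-concordance.* Along a line, the reciprocal of the local norm is `1`-Lipschitz
(`IsSelfConcordantBarrier.abs_localNorm_sub_le`). Hence the Dikin ellipsoid stays in `K`, the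
Hessian is nondegenerate, and the gradient is strongly monotone in the local norm, so one step
moves the leader by at most `2 η b`. With the logarithmic growth of the barrier this bounds the
regret of the leader by `2 N η b² + ν log T / η` over `N` blocks
(`IsSelfConcordantBarrier.sum_inner_sub_rftlPoint_le`), after the comparator has been moved into the
interior by a relative distance `1 / T`.

The point of a block is a measurable function of the coins of the earlier blocks, hence independent
of its own coins, and conditioning on it joins the three facts (`BanditMLSM.integral_block_le`).
Each block loses one exploration round. With the given `η` and `L` all terms are of order
`d^{4/3} T^{2/3}` or `ν d^{4/3} T^{2/3} log T`, and the latter dominates because `ν ≥ 1/6`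
(`IsSelfConcordantBarrier.one_div_six_le`). The stability of the leader requires `η b ≤ 1/2`, and
rounding up `L` must not change its order; when `T^{1/3} ≤ 8 L₁ D` or `T^{1/3} ≤ d^{4/3}` these may
fail, but then the trivial bound `T L₁ D` is small enough.
-/

/-! ### Self-concordance along a line -/

/-- The local norm `(∇²Φ(x)[h,h])^{1/2}` of the direction `h` at the point `x`. -/
noncomputable def localNorm {d : ℕ} (Φ : Vec d → ℝ) (x h : Vec d) : ℝ :=
  √(iteratedFDeriv ℝ 2 Φ x (fun _ => h))

lemma localNorm_nonneg {d : ℕ} (Φ : Vec d → ℝ) (x h : Vec d) : 0 ≤ localNorm Φ x h :=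
  Real.sqrt_nonneg _

lemma localNorm_smul {d : ℕ} (Φ : Vec d → ℝ) (x h : Vec d) (r : ℝ) :
    localNorm Φ x (r • h) = |r| * localNorm Φ x h := by
  have : iteratedFDeriv ℝ 2 Φ x (fun _ => r • h)
      = r ^ 2 * iteratedFDeriv ℝ 2 Φ x (fun _ => h) := by
    simp only [iteratedFDeriv_two_apply, map_smul, _root_.smul_apply, smul_eq_mul]
    ring
  rw [localNorm, localNorm, this, Real.sqrt_mul (sq_nonneg r), Real.sqrt_sq_eq_abs]

/-- The differential inequality `|φ'| ≤ 2 φ^{3/2}` says that `φ^{-1/2}` is `1`-Lipschitz. The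
conclusion is stated without division so that it also covers zeros of `φ`. -/
lemma abs_sqrt_sub_sqrt_le {φ φ' : ℝ → ℝ} {a b : ℝ} (hab : a ≤ b)
    (hd : ∀ t ∈ Set.Icc a b, HasDerivAt φ (φ' t) t) (h0 : ∀ t ∈ Set.Icc a b, 0 ≤ φ t)
    (hb : ∀ t ∈ Set.Icc a b, |φ' t| ≤ 2 * φ t ^ (3 / 2 : ℝ)) :
    |√(φ a) - √(φ b)| ≤ (b - a) * (√(φ a) * √(φ b)) := by
  -- Replacing `φ` by `φ + ε` avoids the zeros of `φ`.
  have key : ∀ ε : ℝ, 0 < ε →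
      |√(φ a + ε) - √(φ b + ε)| ≤ (b - a) * (√(φ a + ε) * √(φ b + ε)) := by
    intro ε hε
    have hder : ∀ t ∈ Set.Icc a b, HasDerivWithinAt (fun t => (√(φ t + ε))⁻¹)
        (-(φ' t / (2 * √(φ t + ε))) / √(φ t + ε) ^ 2) (Set.Icc a b) t := by
      intro t ht
      have hpos : 0 < φ t + ε := add_pos_of_nonneg_of_pos (h0 t ht) hε
      exact ((((hd t ht).add_const ε).sqrt hpos.ne').inv
        (Real.sqrt_pos.2 hpos).ne').hasDerivWithinAt
    have hbd : ∀ t ∈ Set.Icc a b,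
        ‖-(φ' t / (2 * √(φ t + ε))) / √(φ t + ε) ^ 2‖ ≤ 1 := by
      intro t ht
      have hpos : 0 < φ t + ε := add_pos_of_nonneg_of_pos (h0 t ht) hε
      have hs : 0 < √(φ t + ε) := Real.sqrt_pos.2 hpos
      have h1 : |φ' t| ≤ 2 * √(φ t + ε) ^ 3 := by
        refine (hb t ht).trans ?_
        have := Real.rpow_div_two_eq_sqrt (3 : ℝ) (h0 t ht)
        rw [this]
        have h2 : √(φ t) ≤ √(φ t + ε) := Real.sqrt_le_sqrt (by linarith)
        have h3 : √(φ t) ^ (3 : ℝ) = √(φ t) ^ 3 := by norm_cast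
        rw [h3]
        gcongr
      rw [Real.norm_eq_abs, abs_div, abs_neg, abs_div,
        abs_of_pos (by positivity : 0 < 2 * √(φ t + ε)),
        abs_of_pos (by positivity : 0 < √(φ t + ε) ^ 2), div_div, div_le_one (by positivity)]
      linarith
    have := (convex_Icc a b).norm_image_sub_le_of_norm_hasDerivWithin_le hder hbd
      (Set.left_mem_Icc.2 hab) (Set.right_mem_Icc.2 hab)
    have hA : 0 < √(φ a + ε) :=
      Real.sqrt_pos.2 (add_pos_of_nonneg_of_pos (h0 a (Set.left_mem_Icc.2 hab)) hε)
    have hB : 0 < √(φ b + ε) :=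
      Real.sqrt_pos.2 (add_pos_of_nonneg_of_pos (h0 b (Set.right_mem_Icc.2 hab)) hε)
    rw [Real.norm_eq_abs, Real.norm_eq_abs, abs_of_nonneg (sub_nonneg.2 hab), one_mul] at this
    have e : (√(φ b + ε))⁻¹ - (√(φ a + ε))⁻¹
        = (√(φ a + ε) - √(φ b + ε)) / (√(φ a + ε) * √(φ b + ε)) := by
      field_simp
    rwa [e, abs_div, abs_of_pos (mul_pos hA hB), div_le_iff₀ (mul_pos hA hB)] at this
  have hc : Continuous fun ε : ℝ => |√(φ a + ε) - √(φ b + ε)| := by fun_prop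
  have hc' : Continuous fun ε : ℝ => (b - a) * (√(φ a + ε) * √(φ b + ε)) := by fun_prop
  have l1 := (hc.tendsto 0).mono_left (nhdsWithin_le_nhds (s := Set.Ioi 0))
  have l2 := (hc'.tendsto 0).mono_left (nhdsWithin_le_nhds (s := Set.Ioi 0))
  simp only [add_zero] at l1 l2
  exact le_of_tendsto_of_tendsto l1 l2 (eventually_mem_nhdsWithin.mono key)

namespace IsSelfConcordantBarrier

variable {d : ℕ} {K : Set (Vec d)} {ν : ℝ} {Φ : Vec d → ℝ}

lemma contDiffAt (hΦ : IsSelfConcordantBarrier K ν Φ) {x : Vec d} (hx : x ∈ interior K) :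
    ContDiffAt ℝ 3 Φ x :=
  hΦ.contDiffOn.contDiffAt (isOpen_interior.mem_nhds hx)

lemma hasDerivAt_line (hΦ : IsSelfConcordantBarrier K ν Φ) {x h : Vec d} {t : ℝ}
    (hx : x + t • h ∈ interior K) :
    HasDerivAt (fun t : ℝ => Φ (x + t • h)) (fderiv ℝ Φ (x + t • h) h) t := by
  have h1 : HasDerivAt (fun t : ℝ => x + t • h) h t := by
    simpa using ((hasDerivAt_id t).smul_const h).const_add x
  exact ((hΦ.contDiffAt hx).differentiableAt (by norm_num)).hasFDerivAt.comp_hasDerivAt t h1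

lemma hasDerivAt_iteratedFDeriv_line (hΦ : IsSelfConcordantBarrier K ν Φ) {x h : Vec d} {t : ℝ}
    (n : ℕ) (hn : n < 3) (hx : x + t • h ∈ interior K) :
    HasDerivAt (fun t : ℝ => iteratedFDeriv ℝ n Φ (x + t • h) (fun _ => h))
      (iteratedFDeriv ℝ (n + 1) Φ (x + t • h) (fun _ => h)) t := by
  have h1 : HasDerivAt (fun t : ℝ => x + t • h) h t := by
    simpa using ((hasDerivAt_id t).smul_const h).const_add x
  have h2 : DifferentiableAt ℝ (iteratedFDeriv ℝ n Φ) (x + t • h) :=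
    (hΦ.contDiffAt hx).differentiableAt_iteratedFDeriv (by exact_mod_cast hn)
  have h3 := h2.hasFDerivAt.comp_hasDerivAt t h1
  have h4 := ((ContinuousMultilinearMap.apply ℝ (fun _ : Fin n => Vec d) ℝ
    (fun _ => h)).hasFDerivAt (x := iteratedFDeriv ℝ n Φ (x + t • h))).comp_hasDerivAt t h3
  rw [iteratedFDeriv_succ_apply_left]
  exact h4

lemma hasDerivAt_fderiv_line (hΦ : IsSelfConcordantBarrier K ν Φ) {x h : Vec d} {t : ℝ}
    (hx : x + t • h ∈ interior K) :
    HasDerivAt (fun t : ℝ => fderiv ℝ Φ (x + t • h) h)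
      (iteratedFDeriv ℝ 2 Φ (x + t • h) (fun _ => h)) t := by
  simpa [iteratedFDeriv_one_apply] using hΦ.hasDerivAt_iteratedFDeriv_line 1 (by norm_num) hx

lemma convexOn_line (hΦ : IsSelfConcordantBarrier K ν Φ) (x h : Vec d) :
    ConvexOn ℝ ((fun t : ℝ => x + t • h) ⁻¹' interior K) (fun t : ℝ => Φ (x + t • h)) := by
  have := hΦ.convexOn.comp_affineMap (AffineMap.lineMap x (x + h))
  have e : (fun t : ℝ => x + t • h) = AffineMap.lineMap (k := ℝ) x (x + h) := by
    ext1 t; simp [AffineMap.lineMap_apply, add_comm]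
  rw [show (fun t : ℝ => Φ (x + t • h)) = Φ ∘ fun t : ℝ => x + t • h from rfl, e]
  exact this

lemma iteratedFDeriv_two_nonneg (hΦ : IsSelfConcordantBarrier K ν Φ) {x : Vec d}
    (hx : x ∈ interior K) (h : Vec d) : 0 ≤ iteratedFDeriv ℝ 2 Φ x (fun _ => h) := by
  set S : Set ℝ := (fun t : ℝ => x + t • h) ⁻¹' interior K with hS
  have hopen : IsOpen S := isOpen_interior.preimage (by fun_prop)
  have h0 : (0 : ℝ) ∈ S := by simpa [hS] using hx
  have hmono : MonotoneOn (deriv fun t : ℝ => Φ (x + t • h)) S :=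
    (hΦ.convexOn_line x h).monotoneOn_deriv fun t ht => (hΦ.hasDerivAt_line ht).differentiableAt
  have hmono' : MonotoneOn (fun t : ℝ => fderiv ℝ Φ (x + t • h) h) S :=
    hmono.congr fun t ht => (hΦ.hasDerivAt_line ht).deriv
  have h1 := hmono'.derivWithin_nonneg (x := 0)
  rw [derivWithin_of_isOpen hopen h0] at h1
  have h2 := (hΦ.hasDerivAt_fderiv_line (x := x) (h := h) (t := 0) h0).deriv
  rw [h2] at h1
  simpa using h1

lemma sq_localNorm (hΦ : IsSelfConcordantBarrier K ν Φ) {x : Vec d}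
    (hx : x ∈ interior K) (h : Vec d) :
    localNorm Φ x h ^ 2 = iteratedFDeriv ℝ 2 Φ x (fun _ => h) :=
  Real.sq_sqrt (hΦ.iteratedFDeriv_two_nonneg hx h)

lemma add_smul_mem_interior (hΦ : IsSelfConcordantBarrier K ν Φ) {x h : Vec d}
    (hx : x ∈ interior K) (hy : x + h ∈ interior K) {t : ℝ} (ht : t ∈ Set.Icc (0 : ℝ) 1) :
    x + t • h ∈ interior K :=
  hΦ.convex_set.interior.add_smul_mem hx hy ht

/-- The local norms of a direction at two points of a line in that direction: their reciprocals
differ by at most the distance, measured in multiples of the direction. -/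
lemma abs_localNorm_sub_le (hΦ : IsSelfConcordantBarrier K ν Φ) {x h : Vec d} {t : ℝ}
    (ht : 0 ≤ t) (hx : x ∈ interior K) (hy : x + t • h ∈ interior K) :
    |localNorm Φ x h - localNorm Φ (x + t • h) h|
      ≤ t * (localNorm Φ x h * localNorm Φ (x + t • h) h) := by
  have hmem : ∀ s ∈ Set.Icc 0 t, x + s • h ∈ interior K := by
    intro s hs
    rcases ht.eq_or_lt with rfl | htpos
    · have : s = 0 := le_antisymm hs.2 hs.1
      simpa [this] using hx
    · have := hΦ.add_smul_mem_interior hx hy (t := s / t)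
        ⟨div_nonneg hs.1 ht, (div_le_one htpos).2 hs.2⟩
      rwa [smul_smul, div_mul_cancel₀ _ htpos.ne'] at this
  have := abs_sqrt_sub_sqrt_le ht
    (fun s hs => hΦ.hasDerivAt_iteratedFDeriv_line (h := h) 2 (by norm_num) (hmem s hs))
    (fun s hs => hΦ.iteratedFDeriv_two_nonneg (hmem s hs) h)
    (fun s hs => hΦ.third_le _ (hmem s hs) h)
  simpa [localNorm] using this

/-- A ray from an interior point along which the barrier stays bounded does not leave the
interior. -/
lemma line_mem_interior_of_bounded (hΦ : IsSelfConcordantBarrier K ν Φ) (hK : IsClosed K)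
    {x h : Vec d} (hx : x ∈ interior K) {B : ℝ}
    (hB : ∀ t ∈ Set.Icc (0 : ℝ) 1, (∀ s ∈ Set.Icc 0 t, x + s • h ∈ interior K) →
      Φ (x + t • h) ≤ B) {t : ℝ} (ht : t ∈ Set.Icc (0 : ℝ) 1) : x + t • h ∈ interior K := by
  by_contra hcon
  set S : Set ℝ := Set.Icc 0 1 ∩ (fun t : ℝ => x + t • h) ⁻¹' (interior K)ᶜ with hS
  have hcl : IsClosed S :=
    isClosed_Icc.inter (isOpen_interior.isClosed_compl.preimage (by fun_prop))
  have hbdd : BddBelow S := ⟨0, fun s hs => hs.1.1⟩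
  have hmin : sInf S ∈ S := hcl.csInf_mem ⟨t, ht, hcon⟩ hbdd
  set b := sInf S with hb
  have hlt : ∀ s ∈ Set.Ico 0 b, x + s • h ∈ interior K := by
    intro s hs
    by_contra hc
    exact absurd (csInf_le hbdd ⟨⟨hs.1, hs.2.le.trans hmin.1.2⟩, hc⟩) (not_le.2 hs.2)
  have hb0 : 0 < b := by
    refine lt_of_le_of_ne hmin.1.1 fun h0 => hmin.2 ?_
    simpa [← h0] using hx
  have hcont : Tendsto (fun s : ℝ => x + s • h) (𝓝[<] b) (𝓝 (x + b • h)) :=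
    ((by fun_prop : Continuous fun s : ℝ => x + s • h).tendsto b).mono_left nhdsWithin_le_nhds
  have hev : ∀ᶠ s in 𝓝[<] b, s ∈ Set.Ico 0 b := Ico_mem_nhdsLT hb0
  have htend : Tendsto (fun s : ℝ => x + s • h) (𝓝[<] b) (𝓝[interior K] (x + b • h)) :=
    tendsto_nhdsWithin_iff.2 ⟨hcont, hev.mono hlt⟩
  have hfr : x + b • h ∈ frontier K := by
    rw [hK.frontier_eq]
    refine ⟨hK.mem_of_tendsto hcont (hev.mono fun s hs => interior_subset (hlt s hs)), hmin.2⟩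
  have hinf := (hΦ.tendsto_boundary _ hfr).comp htend
  obtain ⟨s, hs1, hs2⟩ := ((hinf.eventually_gt_atTop B).and hev).exists
  exact absurd (hB s ⟨hs2.1, hs2.2.le.trans hmin.1.2⟩
    fun r hr => hlt r ⟨hr.1, hr.2.trans_lt hs2.2⟩) (not_le.2 hs1)


/-! ### Consequences of self-concordance -/

lemma localNorm_add_le (hΦ : IsSelfConcordantBarrier K ν Φ) {x h : Vec d} {t : ℝ}
    (ht : t ∈ Set.Icc (0 : ℝ) 1) (hx : x ∈ interior K) (hy : x + t • h ∈ interior K)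
    (hr : localNorm Φ x h < 1) :
    localNorm Φ (x + t • h) h ≤ localNorm Φ x h / (1 - localNorm Φ x h) := by
  have h1 := (abs_le.1 (hΦ.abs_localNorm_sub_le ht.1 hx hy)).1
  have h2 : t * (localNorm Φ x h * localNorm Φ (x + t • h) h)
      ≤ localNorm Φ x h * localNorm Φ (x + t • h) h :=
    mul_le_of_le_one_left (mul_nonneg (localNorm_nonneg _ _ _) (localNorm_nonneg _ _ _)) ht.2
  rw [le_div_iff₀ (by linarith)]
  linarith

/-- The open Dikin ellipsoid lies in the interior: inside it the second derivative along a ray is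
bounded, hence so is the barrier. -/
lemma add_mem_interior (hΦ : IsSelfConcordantBarrier K ν Φ) (hK : IsClosed K)
    {x h : Vec d} (hx : x ∈ interior K) (hr : localNorm Φ x h < 1) : x + h ∈ interior K := by
  set M : ℝ := (localNorm Φ x h / (1 - localNorm Φ x h)) ^ 2
  have hM : 0 ≤ M := sq_nonneg _
  have := hΦ.line_mem_interior_of_bounded hK hx (h := h)
    (B := Φ x + (|fderiv ℝ Φ x h| + M)) ?_ (t := 1) ⟨zero_le_one, le_rfl⟩
  · simpa using this
  intro t ht hmem
  have h2 : ∀ s ∈ Set.Icc 0 t, ‖iteratedFDeriv ℝ 2 Φ (x + s • h) (fun _ => h)‖ ≤ M := by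
    intro s hs
    rw [← hΦ.sq_localNorm (hmem s hs), Real.norm_eq_abs, abs_of_nonneg (sq_nonneg _)]
    have := hΦ.localNorm_add_le ⟨hs.1, hs.2.trans ht.2⟩ hx (hmem s hs) hr
    exact pow_le_pow_left₀ (localNorm_nonneg _ _ _) this 2
  have h1 : ∀ s ∈ Set.Icc 0 t, ‖fderiv ℝ Φ (x + s • h) h‖ ≤ |fderiv ℝ Φ x h| + M := by
    intro s hs
    have := (convex_Icc 0 t).norm_image_sub_le_of_norm_hasDerivWithin_le
      (fun r hr => (hΦ.hasDerivAt_fderiv_line (hmem r hr)).hasDerivWithinAt) h2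
      (Set.left_mem_Icc.2 ht.1) hs
    simp only [zero_smul, add_zero, sub_zero, Real.norm_eq_abs, abs_of_nonneg hs.1] at this
    have h3 : M * s ≤ M := mul_le_of_le_one_right hM (hs.2.trans ht.2)
    have h4 := abs_sub_abs_le_abs_sub (fderiv ℝ Φ (x + s • h) h) (fderiv ℝ Φ x h)
    rw [Real.norm_eq_abs]
    linarith
  have := (convex_Icc 0 t).norm_image_sub_le_of_norm_hasDerivWithin_le
      (fun r hr => (hΦ.hasDerivAt_line (hmem r hr)).hasDerivWithinAt) h1
      (Set.left_mem_Icc.2 ht.1) (Set.right_mem_Icc.2 ht.1)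
  simp only [zero_smul, add_zero, sub_zero, Real.norm_eq_abs, abs_of_nonneg ht.1] at this
  have h3 : (|fderiv ℝ Φ x h| + M) * t ≤ |fderiv ℝ Φ x h| + M :=
    mul_le_of_le_one_right (by positivity) ht.2
  linarith [le_abs_self (Φ (x + t • h) - Φ x)]

/-- The closed Dikin ellipsoid lies in `K`. -/
lemma add_mem (hΦ : IsSelfConcordantBarrier K ν Φ) (hK : IsClosed K)
    {x h : Vec d} (hx : x ∈ interior K) (hr : localNorm Φ x h ≤ 1) : x + h ∈ K := by
  have hcont : Tendsto (fun s : ℝ => x + s • h) (𝓝[<] 1) (𝓝 (x + (1 : ℝ) • h)) :=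
    ((by fun_prop : Continuous fun s : ℝ => x + s • h).tendsto 1).mono_left nhdsWithin_le_nhds
  rw [one_smul] at hcont
  refine hK.mem_of_tendsto hcont ?_
  filter_upwards [Ico_mem_nhdsLT (zero_lt_one (α := ℝ))] with s hs
  refine interior_subset (hΦ.add_mem_interior hK hx ?_)
  rw [localNorm_smul, abs_of_nonneg hs.1]
  nlinarith [hs.1, hs.2, localNorm_nonneg Φ x h]

/-- The Hessian of a barrier of a bounded set is nondegenerate, since the Dikin ellipsoid is
bounded. -/
lemma eq_zero_of_localNorm_eq_zero (hΦ : IsSelfConcordantBarrier K ν Φ) (hK : IsCompact K)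
    {x h : Vec d} (hx : x ∈ interior K) (hr : localNorm Φ x h = 0) : h = 0 := by
  obtain ⟨R, hR⟩ := hK.isBounded.exists_norm_le
  by_contra hne
  have hpos : 0 < ‖h‖ := norm_pos_iff.2 hne
  obtain ⟨n, hn⟩ := exists_nat_gt ((R + ‖x‖) / ‖h‖)
  have hmem := hΦ.add_mem hK.isClosed hx (h := (n : ℝ) • h) (by simp [localNorm_smul, hr])
  have h1 := hR _ hmem
  have h2 : ‖(n : ℝ) • h‖ ≤ ‖x + (n : ℝ) • h‖ + ‖x‖ := by
    simpa using norm_sub_le (x + (n : ℝ) • h) x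
  rw [norm_smul, Real.norm_natCast] at h2
  rw [div_lt_iff₀ hpos] at hn
  linarith

/-- Strong monotonicity of the gradient, measured in the local norm. -/
lemma le_fderiv_sub_fderiv (hΦ : IsSelfConcordantBarrier K ν Φ) {x h : Vec d}
    (hx : x ∈ interior K) (hy : x + h ∈ interior K) :
    localNorm Φ x h ^ 2 / (1 + localNorm Φ x h) ≤ fderiv ℝ Φ (x + h) h - fderiv ℝ Φ x h := by
  set r := localNorm Φ x h with hr
  have hr0 : 0 ≤ r := localNorm_nonneg _ _ _
  have hmem : ∀ s ∈ Set.Icc (0 : ℝ) 1, x + s • h ∈ interior K :=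
    fun s hs => hΦ.add_smul_mem_interior hx hy hs
  have hder : ∀ s ∈ Set.Icc (0 : ℝ) 1, HasDerivAt
      (fun s : ℝ => fderiv ℝ Φ (x + s • h) h + r * (1 + r * s)⁻¹)
      (iteratedFDeriv ℝ 2 Φ (x + s • h) (fun _ => h) + r * (-r / (1 + r * s) ^ 2)) s := by
    intro s hs
    have hne : 1 + r * s ≠ 0 := by have := mul_nonneg hr0 hs.1; positivity
    have h1 : HasDerivAt (fun s : ℝ => 1 + r * s) r s := by
      simpa using ((hasDerivAt_id s).const_mul r).const_add 1
    exact (hΦ.hasDerivAt_fderiv_line (hmem s hs)).add ((h1.inv hne).const_mul r)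
  have hmono := monotoneOn_of_deriv_nonneg (convex_Icc (0 : ℝ) 1)
    (fun s hs => (hder s hs).continuousAt.continuousWithinAt)
    (fun s hs => (hder s (interior_subset hs)).differentiableAt.differentiableWithinAt)
    (fun s hs => by
      have hs := interior_subset hs
      rw [(hder s hs).deriv, ← hΦ.sq_localNorm (hmem s hs)]
      have hpos : 0 < 1 + r * s := by have := mul_nonneg hr0 hs.1; positivity
      have h1 := (abs_le.1 (hΦ.abs_localNorm_sub_le hs.1 hx (hmem s hs))).2
      have h2 : r / (1 + r * s) ≤ localNorm Φ (x + s • h) h := by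
        rw [div_le_iff₀ hpos]
        linarith
      have h3 := pow_le_pow_left₀ (div_nonneg hr0 hpos.le) h2 2
      have h4 : r * (-r / (1 + r * s) ^ 2) = -(r / (1 + r * s)) ^ 2 := by
        field_simp
      rw [h4]
      linarith)
  have := hmono (Set.left_mem_Icc.2 zero_le_one) (Set.right_mem_Icc.2 zero_le_one) zero_le_one
  simp only [zero_smul, add_zero, mul_zero, inv_one, mul_one, one_smul] at this
  have e : r ^ 2 / (1 + r) = r - r * (1 + r)⁻¹ := by
    field_simp
    ring
  rw [e]
  linarith

lemma add_smul_sub_mem_interior (hΦ : IsSelfConcordantBarrier K ν Φ) {x y : Vec d}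
    (hx : x ∈ interior K) (hy : y ∈ K) {t : ℝ} (ht : t ∈ Set.Ico (0 : ℝ) 1) :
    x + t • (y - x) ∈ interior K := by
  have := hΦ.convex_set.combo_interior_self_mem_interior hx hy (sub_pos.2 ht.2) ht.1 (by ring)
  convert this using 1
  module

/-- The barrier parameter bounds the derivative in every direction pointing into `K`. -/
lemma fderiv_sub_le (hΦ : IsSelfConcordantBarrier K ν Φ) {x y : Vec d}
    (hx : x ∈ interior K) (hy : y ∈ K) : fderiv ℝ Φ x (y - x) ≤ ν := by
  by_contra! hcon
  set h := y - x with hh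
  have hρ0 : 0 < fderiv ℝ Φ x h := hΦ.nonneg.trans_lt hcon
  have hmem : ∀ t ∈ Set.Ico (0 : ℝ) 1, x + t • h ∈ interior K :=
    fun t ht => hΦ.add_smul_sub_mem_interior hx hy ht
  have hmono1 : MonotoneOn (fun t : ℝ => fderiv ℝ Φ (x + t • h) h) (Set.Ico 0 1) :=
    monotoneOn_of_deriv_nonneg (convex_Ico 0 1)
      (fun s hs => (hΦ.hasDerivAt_fderiv_line (hmem s hs)).continuousAt.continuousWithinAt)
      (fun s hs => (hΦ.hasDerivAt_fderiv_line
        (hmem s (interior_subset hs))).differentiableAt.differentiableWithinAt)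
      (fun s hs => by
        rw [(hΦ.hasDerivAt_fderiv_line (hmem s (interior_subset hs))).deriv]
        exact hΦ.iteratedFDeriv_two_nonneg (hmem s (interior_subset hs)) h)
  have hpos : ∀ t ∈ Set.Ico (0 : ℝ) 1, 0 < fderiv ℝ Φ (x + t • h) h := by
    intro t ht
    have := hmono1 (Set.left_mem_Ico.2 zero_lt_one) ht ht.1
    simp only [zero_smul, add_zero] at this
    linarith
  have hder : ∀ t ∈ Set.Ico (0 : ℝ) 1, HasDerivAt
      (fun t : ℝ => -(ν * (fderiv ℝ Φ (x + t • h) h)⁻¹) - t)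
      (-(ν * (-(iteratedFDeriv ℝ 2 Φ (x + t • h) (fun _ => h))
        / fderiv ℝ Φ (x + t • h) h ^ 2)) - 1) t := by
    intro t ht
    exact (((hΦ.hasDerivAt_fderiv_line (hmem t ht)).inv (hpos t ht).ne').const_mul ν).neg.sub
      (hasDerivAt_id t)
  have hmono2 := monotoneOn_of_deriv_nonneg (convex_Ico (0 : ℝ) 1)
    (fun s hs => (hder s hs).continuousAt.continuousWithinAt)
    (fun s hs => (hder s (interior_subset hs)).differentiableAt.differentiableWithinAt)
    (fun s hs => by
      have hs := interior_subset hs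
      rw [(hder s hs).deriv]
      have h1 := hΦ.first_le _ (hmem s hs) h
      have h2 := hΦ.iteratedFDeriv_two_nonneg (hmem s hs) h
      rw [← Real.mul_rpow hΦ.nonneg h2, ← Real.sqrt_eq_rpow] at h1
      have h3 := pow_le_pow_left₀ (abs_nonneg _) h1 2
      rw [Real.sq_sqrt (mul_nonneg hΦ.nonneg h2), sq_abs] at h3
      have h4 : 1 ≤ ν * iteratedFDeriv ℝ 2 Φ (x + s • h) (fun _ => h)
          / fderiv ℝ Φ (x + s • h) h ^ 2 := by
        rwa [le_div_iff₀ (pow_pos (hpos s hs) 2), one_mul]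
      have e : -(ν * (-(iteratedFDeriv ℝ 2 Φ (x + s • h) (fun _ => h))
          / fderiv ℝ Φ (x + s • h) h ^ 2)) = ν * iteratedFDeriv ℝ 2 Φ (x + s • h) (fun _ => h)
          / fderiv ℝ Φ (x + s • h) h ^ 2 := by ring
      rw [e]
      linarith)
  set ρ := fderiv ℝ Φ x h with hρ
  have hfin : ν / ρ < 1 := (div_lt_one hρ0).2 hcon
  obtain ⟨t, ht1, ht2⟩ := exists_between hfin
  have ht : t ∈ Set.Ico (0 : ℝ) 1 := ⟨(div_nonneg hΦ.nonneg hρ0.le).trans ht1.le, ht2⟩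
  have := hmono2 (Set.left_mem_Ico.2 zero_lt_one) ht ht.1
  simp only [zero_smul, add_zero, ← hρ] at this
  have h5 : 0 ≤ ν * (fderiv ℝ Φ (x + t • h) h)⁻¹ :=
    mul_nonneg hΦ.nonneg (inv_nonneg.2 (hpos t ht).le)
  rw [← div_eq_mul_inv ν ρ] at this
  linarith

/-- The barrier grows at most logarithmically towards the boundary. -/
lemma sub_le_log (hΦ : IsSelfConcordantBarrier K ν Φ) {x y : Vec d}
    (hx : x ∈ interior K) (hy : y ∈ K) {t : ℝ} (ht : t ∈ Set.Ico (0 : ℝ) 1) :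
    Φ (x + t • (y - x)) - Φ x ≤ -(ν * Real.log (1 - t)) := by
  set h := y - x with hh
  have hmem : ∀ t ∈ Set.Ico (0 : ℝ) 1, x + t • h ∈ interior K :=
    fun t ht => hΦ.add_smul_sub_mem_interior hx hy ht
  have hder : ∀ t ∈ Set.Ico (0 : ℝ) 1, HasDerivAt
      (fun t : ℝ => -(ν * Real.log (1 - t)) - Φ (x + t • h))
      (-(ν * (-1 / (1 - t))) - fderiv ℝ Φ (x + t • h) h) t := by
    intro t ht
    have h1 : HasDerivAt (fun t : ℝ => 1 - t) (-1) t := by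
      simpa using (hasDerivAt_id t).const_sub 1
    exact ((h1.log (sub_pos.2 ht.2).ne').const_mul ν).neg.sub (hΦ.hasDerivAt_line (hmem t ht))
  have hmono := monotoneOn_of_deriv_nonneg (convex_Ico (0 : ℝ) 1)
    (fun s hs => (hder s hs).continuousAt.continuousWithinAt)
    (fun s hs => (hder s (interior_subset hs)).differentiableAt.differentiableWithinAt)
    (fun s hs => by
      have hs := interior_subset hs
      rw [(hder s hs).deriv]
      have hpos := sub_pos.2 hs.2
      have h1 := hΦ.fderiv_sub_le (hmem s hs) hy
      have e : y - (x + s • h) = (1 - s) • h := by rw [hh]; module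
      rw [e, map_smul, smul_eq_mul] at h1
      have h2 : fderiv ℝ Φ (x + s • h) h ≤ ν / (1 - s) := by
        rw [le_div_iff₀ hpos]; linarith
      have e2 : -(ν * (-1 / (1 - s))) = ν / (1 - s) := by ring
      rw [e2]
      linarith)
  have := hmono (Set.left_mem_Ico.2 zero_lt_one) ht ht.1
  simp only [sub_zero, Real.log_one, mul_zero, neg_zero, zero_smul, add_zero] at this
  linarith

end IsSelfConcordantBarrier

/-! ### The regularized leader -/

namespace IsSelfConcordantBarrier

variable {d : ℕ} {K : Set (Vec d)} {ν : ℝ} {Φ : Vec d → ℝ}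

lemma continuousOn (hΦ : IsSelfConcordantBarrier K ν Φ) : ContinuousOn Φ (interior K) :=
  hΦ.contDiffOn.continuousOn

/-- Sublevel sets of the barrier plus a linear function are compact. -/
lemma isCompact_sublevel (hΦ : IsSelfConcordantBarrier K ν Φ) (hK : IsCompact K)
    (g : Vec d) (B : ℝ) : IsCompact {x ∈ interior K | -⟪g, x⟫ + Φ x ≤ B} := by
  refine hK.of_isClosed_subset ?_ fun x hx => interior_subset hx.1
  refine isClosed_of_closure_subset fun x hx => ?_
  set S := {x ∈ interior K | -⟪g, x⟫ + Φ x ≤ B} with hS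
  have hSK : S ⊆ interior K := fun y hy => hy.1
  have hne : (𝓝[S] x).NeBot := mem_closure_iff_nhdsWithin_neBot.1 hx
  have hlin : Tendsto (fun y : Vec d => -⟪g, y⟫) (𝓝[S] x) (𝓝 (-⟪g, x⟫)) :=
    ((by fun_prop : Continuous fun y : Vec d => -⟪g, y⟫).tendsto x).mono_left nhdsWithin_le_nhds
  by_cases hxi : x ∈ interior K
  · refine ⟨hxi, le_of_tendsto (hlin.add ((hΦ.continuousOn x hxi).mono hSK)) ?_⟩
    exact eventually_mem_nhdsWithin.mono fun y hy => hy.2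
  · have hxK : x ∈ K :=
      closure_minimal (hSK.trans interior_subset) hK.isClosed hx
    have hfr : x ∈ frontier K := by rw [hK.isClosed.frontier_eq]; exact ⟨hxK, hxi⟩
    have h1 : Tendsto Φ (𝓝[S] x) atTop :=
      (hΦ.tendsto_boundary x hfr).mono_left (nhdsWithin_mono x hSK)
    have h2 := hlin.add_atTop h1
    obtain ⟨y, hy1, hy2⟩ := ((h2.eventually_gt_atTop B).and eventually_mem_nhdsWithin).exists
    exact absurd hy2.2 (not_le.2 hy1)

lemma exists_isMinOn (hΦ : IsSelfConcordantBarrier K ν Φ) (hK : IsCompact K) (g : Vec d) :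
    ∃ x ∈ interior K, ∀ y ∈ interior K, -⟪g, x⟫ + Φ x ≤ -⟪g, y⟫ + Φ y := by
  obtain ⟨x₀, hx₀⟩ := hΦ.interior_nonempty
  obtain ⟨x, hx, hmin⟩ := (hΦ.isCompact_sublevel hK g (-⟪g, x₀⟫ + Φ x₀)).exists_isMinOn
    ⟨x₀, hx₀, le_rfl⟩ (f := fun x => -⟪g, x⟫ + Φ x)
    (ContinuousOn.add (by fun_prop) (hΦ.continuousOn.mono fun x hx => hx.1))
  refine ⟨x, hx.1, fun y hy => ?_⟩
  by_cases h : -⟪g, y⟫ + Φ y ≤ -⟪g, x₀⟫ + Φ x₀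
  · exact hmin ⟨hy, h⟩
  · exact (hx.2.trans (not_le.1 h).le)

open BanditMLSM

lemma rftlPoint_spec (hΦ : IsSelfConcordantBarrier K ν Φ) (hK : IsCompact K) (η : ℝ) (G : Vec d) :
    rftlPoint K Φ η G ∈ interior K ∧ ∀ y ∈ interior K,
      -(η * ⟪G, rftlPoint K Φ η G⟫) + Φ (rftlPoint K Φ η G) ≤ -(η * ⟪G, y⟫) + Φ y := by
  have := hΦ.exists_isMinOn hK (η • G)
  simp only [real_inner_smul_left] at this
  exact Classical.epsilon_spec this

lemma rftlPoint_mem (hΦ : IsSelfConcordantBarrier K ν Φ) (hK : IsCompact K) (η : ℝ) (G : Vec d) :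
    rftlPoint K Φ η G ∈ interior K :=
  (hΦ.rftlPoint_spec hK η G).1

lemma fderiv_rftlPoint (hΦ : IsSelfConcordantBarrier K ν Φ) (hK : IsCompact K) (η : ℝ)
    (G h : Vec d) : fderiv ℝ Φ (rftlPoint K Φ η G) h = η * ⟪G, h⟫ := by
  obtain ⟨hmem, hmin⟩ := hΦ.rftlPoint_spec hK η G
  set x := rftlPoint K Φ η G
  have hloc : IsLocalMin (fun y => -(η * ⟪G, y⟫) + Φ y) x :=
    Filter.eventually_of_mem (isOpen_interior.mem_nhds hmem) hmin
  have h1 : HasFDerivAt (fun y => -(η * ⟪G, y⟫) + Φ y)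
      (-(η • (innerSL ℝ G)) + fderiv ℝ Φ x) x :=
    ((innerSL ℝ G).hasFDerivAt.const_mul η).neg.add
      ((hΦ.contDiffAt hmem).differentiableAt (by norm_num)).hasFDerivAt
  have h2 := hloc.hasFDerivAt_eq_zero h1
  have h3 := congrArg (fun A : Vec d →L[ℝ] ℝ => A h) h2
  simp only [_root_.add_apply, _root_.neg_apply, _root_.smul_apply, innerSL_apply_apply,
    smul_eq_mul, _root_.zero_apply] at h3
  linarith

/-- The gradient of the barrier is injective. -/
lemma fderiv_injOn (hΦ : IsSelfConcordantBarrier K ν Φ) (hK : IsCompact K) :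
    Set.InjOn (fderiv ℝ Φ) (interior K) := by
  intro x hx y hy hxy
  have h1 := hΦ.le_fderiv_sub_fderiv (h := y - x) hx (by simpa using hy)
  rw [add_sub_cancel, hxy, sub_self] at h1
  have h0 := localNorm_nonneg Φ x (y - x)
  have h2 : localNorm Φ x (y - x) = 0 := by
    by_contra hne
    have : 0 < localNorm Φ x (y - x) := lt_of_le_of_ne h0 (Ne.symm hne)
    exact absurd h1 (not_le.2 (by positivity))
  exact (sub_eq_zero.1 (hΦ.eq_zero_of_localNorm_eq_zero hK hx h2)).symm

/-- The barrier parameter of a bounded set of positive dimension is bounded below: from the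
minimizer of `Φ` the Dikin ellipsoid reaches a point of `K` along which `Φ` has grown. -/
lemma one_div_six_le (hΦ : IsSelfConcordantBarrier K ν Φ) (hK : IsCompact K) (hd : 1 ≤ d) :
    1 / 6 ≤ ν := by
  obtain ⟨x, hx⟩ : ∃ x, x = rftlPoint K Φ 0 0 := ⟨_, rfl⟩
  have hmem : x ∈ interior K := hx ▸ hΦ.rftlPoint_mem hK 0 0
  have hgrad : ∀ h, fderiv ℝ Φ x h = 0 := fun h => by
    rw [hx, hΦ.fderiv_rftlPoint hK 0 0 h, zero_mul]
  set e : Vec d := baseVec ⟨0, hd⟩ with he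
  have he0 : e ≠ 0 := by simp [he, baseVec]
  have hn0 : localNorm Φ x e ≠ 0 := fun h => he0 (hΦ.eq_zero_of_localNorm_eq_zero hK hmem h)
  have hn : 0 < localNorm Φ x e := lt_of_le_of_ne (localNorm_nonneg _ _ _) (Ne.symm hn0)
  set h : Vec d := (2 * localNorm Φ x e)⁻¹ • e with hh
  have hhalf : localNorm Φ x h = 1 / 2 := by
    rw [hh, localNorm_smul, abs_of_pos (by positivity)]
    field_simp
  have hin : x + h ∈ interior K :=
    hΦ.add_mem_interior hK.isClosed hmem (by rw [hhalf]; norm_num)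
  have hend : x + (2 : ℝ) • h ∈ K :=
    hΦ.add_mem hK.isClosed hmem (by rw [localNorm_smul, hhalf]; norm_num)
  have h1 := hΦ.le_fderiv_sub_fderiv hmem hin
  have h2 := hΦ.fderiv_sub_le hin hend
  have e2 : x + (2 : ℝ) • h - (x + h) = h := by module
  rw [e2] at h2
  rw [hhalf, hgrad] at h1
  norm_num at h1
  linarith

/-- Stability of the regularized leader: a change `g` of the accumulated gradient whose dual local
norm is at most `b` gains at most `2 η b²` by moving to the new leader. -/
lemma inner_rftlPoint_sub_le (hΦ : IsSelfConcordantBarrier K ν Φ) (hK : IsCompact K) {η b : ℝ}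
    (hη : 0 ≤ η) {G g : Vec d}
    (hg : ∀ h, |⟪g, h⟫| ≤ b * localNorm Φ (rftlPoint K Φ η G) h) (hb : 0 ≤ b)
    (hηb : η * b ≤ 1 / 2) :
    ⟪g, rftlPoint K Φ η (G + g) - rftlPoint K Φ η G⟫ ≤ 2 * η * b ^ 2 := by
  set x := rftlPoint K Φ η G with hx
  set h := rftlPoint K Φ η (G + g) - x with hh
  have hmem : x ∈ interior K := hΦ.rftlPoint_mem hK η G
  have hmem' : x + h ∈ interior K := by
    rw [hh, add_sub_cancel]; exact hΦ.rftlPoint_mem hK η _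
  have h1 := hΦ.le_fderiv_sub_fderiv hmem hmem'
  have h2 : fderiv ℝ Φ (x + h) h = η * ⟪G + g, h⟫ := by
    rw [hh, add_sub_cancel]; exact hΦ.fderiv_rftlPoint hK η _ _
  have h3 : fderiv ℝ Φ x h = η * ⟪G, h⟫ := hΦ.fderiv_rftlPoint hK η _ _
  rw [h2, h3, inner_add_left] at h1
  have h4 := (le_abs_self _).trans (hg h)
  set s := localNorm Φ x h with hs
  have hs0 : 0 ≤ s := localNorm_nonneg _ _ _
  have h5 : s ^ 2 / (1 + s) ≤ η * b * s := by nlinarith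
  rw [div_le_iff₀ (by positivity)] at h5
  have h6 : s ≤ 2 * (η * b) := by
    by_contra! hcon
    have hηb0 : 0 ≤ η * b := by positivity
    have hspos : 0 < s := by linarith
    have h7 : s ≤ η * b * (1 + s) := by
      have : s * s ≤ s * (η * b * (1 + s)) := by nlinarith
      exact le_of_mul_le_mul_left this hspos
    nlinarith
  calc ⟪g, h⟫ ≤ b * s := h4
    _ ≤ b * (2 * (η * b)) := by gcongr
    _ = 2 * η * b ^ 2 := by ring

/-- The leader computed with hindsight of one more round beats every fixed point, up to the range
of the regularizer. -/
lemma sum_inner_leader (hΦ : IsSelfConcordantBarrier K ν Φ) (hK : IsCompact K) (η : ℝ)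
    (g : ℕ → Vec d) (N : ℕ) {y : Vec d} (hy : y ∈ interior K) :
    Φ (rftlPoint K Φ η 0) - ∑ q ∈ Finset.range N,
        η * ⟪g q, rftlPoint K Φ η (∑ s ∈ Finset.range (q + 1), g s)⟫
      ≤ -(η * ⟪∑ q ∈ Finset.range N, g q, y⟫) + Φ y := by
  induction N generalizing y with
  | zero =>
    have := (hΦ.rftlPoint_spec hK η 0).2 y hy
    simpa using this
  | succ N ih =>
    have h1 := ih (hΦ.rftlPoint_mem hK η (∑ s ∈ Finset.range (N + 1), g s))
    have h2 := (hΦ.rftlPoint_spec hK η (∑ s ∈ Finset.range (N + 1), g s)).2 y hy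
    rw [Finset.sum_range_succ (fun q => η * ⟪g q, _⟫)]
    refine le_trans ?_ h2
    have h3 : ⟪∑ s ∈ Finset.range (N + 1), g s,
          rftlPoint K Φ η (∑ s ∈ Finset.range (N + 1), g s)⟫
        = ⟪∑ s ∈ Finset.range N, g s, rftlPoint K Φ η (∑ s ∈ Finset.range (N + 1), g s)⟫
          + ⟪g N, rftlPoint K Φ η (∑ s ∈ Finset.range (N + 1), g s)⟫ := by
      rw [Finset.sum_range_succ g, inner_add_left]
    rw [h3, mul_add]
    linarith

/-- The regret of the regularized leader against an interior point. -/
lemma sum_inner_sub_rftlPoint_le (hΦ : IsSelfConcordantBarrier K ν Φ) (hK : IsCompact K) {η b : ℝ}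
    (hη : 0 < η) (g : ℕ → Vec d) (N : ℕ) (hb : 0 ≤ b) (hηb : η * b ≤ 1 / 2)
    (hg : ∀ q < N, ∀ h, |⟪g q, h⟫|
      ≤ b * localNorm Φ (rftlPoint K Φ η (∑ s ∈ Finset.range q, g s)) h)
    {y : Vec d} (hy : y ∈ interior K) :
    ∑ q ∈ Finset.range N, ⟪g q, y - rftlPoint K Φ η (∑ s ∈ Finset.range q, g s)⟫
      ≤ N * (2 * η * b ^ 2) + (Φ y - Φ (rftlPoint K Φ η 0)) / η := by
  have h1 := hΦ.sum_inner_leader hK η g N hy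
  have h2 : ∑ q ∈ Finset.range N, ⟪g q, rftlPoint K Φ η (∑ s ∈ Finset.range (q + 1), g s)
      - rftlPoint K Φ η (∑ s ∈ Finset.range q, g s)⟫ ≤ N * (2 * η * b ^ 2) := by
    have := Finset.sum_le_card_nsmul (Finset.range N)
      (fun q => ⟪g q, rftlPoint K Φ η (∑ s ∈ Finset.range (q + 1), g s)
      - rftlPoint K Φ η (∑ s ∈ Finset.range q, g s)⟫) (2 * η * b ^ 2) (fun q hq => by
        rw [Finset.sum_range_succ]
        exact hΦ.inner_rftlPoint_sub_le hK hη.le (hg q (Finset.mem_range.1 hq)) hb hηb)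
    simpa using this
  rw [← Finset.mul_sum, sum_inner] at h1
  have h3 : ∑ q ∈ Finset.range N, ⟪g q, y⟫
      - ∑ q ∈ Finset.range N, ⟪g q, rftlPoint K Φ η (∑ s ∈ Finset.range (q + 1), g s)⟫
      ≤ (Φ y - Φ (rftlPoint K Φ η 0)) / η := by
    rw [le_div_iff₀ hη]
    linarith
  simp only [inner_sub_right, Finset.sum_sub_distrib] at h2 ⊢
  linarith

/-- On bounded sets of accumulated gradients the local norms at the leader are uniformly bounded,
since the leaders stay in a compact part of the interior. -/
lemma exists_localNorm_rftlPoint_le (hΦ : IsSelfConcordantBarrier K ν Φ) (hK : IsCompact K)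
    (η R : ℝ) : ∃ M : ℝ, 0 ≤ M ∧ ∀ G : Vec d, ‖G‖ ≤ R → ∀ h : Vec d,
      localNorm Φ (rftlPoint K Φ η G) h ≤ M * ‖h‖ := by
  obtain ⟨x₀, hx₀⟩ := hΦ.interior_nonempty
  obtain ⟨D, hD⟩ := hK.isBounded.exists_norm_le
  have hD0 : 0 ≤ D := (norm_nonneg _).trans (hD x₀ (interior_subset hx₀))
  set S := {x ∈ interior K | -⟪(0 : Vec d), x⟫ + Φ x ≤ Φ x₀ + |η| * (R * (2 * D))} with hS
  have hSc : IsCompact S := hΦ.isCompact_sublevel hK 0 _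
  have hcont : ContinuousOn (fun x => ‖iteratedFDeriv ℝ 2 Φ x‖) S := by
    intro x hx
    exact ((hΦ.contDiffAt hx.1).continuousAt_iteratedFDeriv
      (by norm_num)).norm.continuousWithinAt
  obtain ⟨M, hM⟩ := hSc.bddAbove_image hcont
  refine ⟨√(max M 0), Real.sqrt_nonneg _, fun G hG h => ?_⟩
  obtain ⟨hmem, hmin⟩ := hΦ.rftlPoint_spec hK η G
  set x := rftlPoint K Φ η G
  have hxS : x ∈ S := by
    refine ⟨hmem, ?_⟩
    have h1 := hmin x₀ hx₀
    have h2 : η * ⟪G, x - x₀⟫ ≤ |η| * (R * (2 * D)) := by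
      refine (le_abs_self _).trans ?_
      rw [abs_mul]
      gcongr
      refine (abs_real_inner_le_norm _ _).trans ?_
      have h3 : ‖x - x₀‖ ≤ 2 * D := by
        have := norm_sub_le x x₀
        linarith [hD x (interior_subset hmem), hD x₀ (interior_subset hx₀)]
      exact mul_le_mul hG h3 (norm_nonneg _) ((norm_nonneg _).trans hG)
    rw [inner_sub_right] at h2
    rw [inner_zero_left]
    linarith
  have h4 : ‖iteratedFDeriv ℝ 2 Φ x‖ ≤ M := hM (Set.mem_image_of_mem _ hxS)
  have h5 : iteratedFDeriv ℝ 2 Φ x (fun _ => h) ≤ max M 0 * ‖h‖ ^ 2 := by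
    refine (le_abs_self _).trans ?_
    have := (iteratedFDeriv ℝ 2 Φ x).le_opNorm (fun _ => h)
    simp only [Finset.prod_const, Finset.card_univ, Fintype.card_fin, Real.norm_eq_abs] at this
    refine this.trans ?_
    gcongr
    exact h4.trans (le_max_left _ _)
  calc localNorm Φ x h ≤ √(max M 0 * ‖h‖ ^ 2) := Real.sqrt_le_sqrt h5
    _ = √(max M 0) * ‖h‖ := by
      rw [Real.sqrt_mul (le_max_right _ _), Real.sqrt_sq (norm_nonneg _)]

end IsSelfConcordantBarrier

/-! ### Multi-linear rewards -/

section Multilinear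

variable {d : ℕ} {f : Vec d → ℝ}

@[simp] lemma baseVec_apply (i j : Fin d) : (baseVec i : Vec d) j = if j = i then 1 else 0 := by
  simp [baseVec]

lemma sum_smul_baseVec (h : Vec d) : ∑ i, h i • baseVec i = h := by
  ext j
  simp

lemma IsMultilinearFun.contDiff (hf : IsMultilinearFun f) : ContDiff ℝ 1 f := by
  obtain ⟨p, -, hp⟩ := hf
  have : f = fun x : Vec d => ∑ m ∈ p.support, p.coeff m * ∏ i, x i ^ m i := by
    ext x; rw [hp, MvPolynomial.eval_eq']
  rw [this]
  fun_prop

lemma IsMultilinearFun.exists_affine (hf : IsMultilinearFun f) (x : Vec d) (i : Fin d) :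
    ∃ b : ℝ, ∀ r : ℝ, f (x + r • baseVec i) = f x + r * b := by
  obtain ⟨p, hdeg, hp⟩ := hf
  refine ⟨∑ m ∈ p.support, p.coeff m *
    ((if m i = 0 then 0 else 1) * ∏ j ∈ Finset.univ.erase i, x j ^ m j), fun r => ?_⟩
  rw [hp, hp, MvPolynomial.eval_eq', MvPolynomial.eval_eq', Finset.mul_sum,
    ← Finset.sum_add_distrib]
  refine Finset.sum_congr rfl fun m hm => ?_
  rw [← Finset.mul_prod_erase Finset.univ _ (Finset.mem_univ i),
    ← Finset.mul_prod_erase Finset.univ (fun j => x j ^ m j) (Finset.mem_univ i)]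
  have h1 : ∏ j ∈ Finset.univ.erase i, (x + r • baseVec i) j ^ m j
      = ∏ j ∈ Finset.univ.erase i, x j ^ m j := by
    refine Finset.prod_congr rfl fun j hj => ?_
    simp [Finset.ne_of_mem_erase hj]
  rw [h1]
  have h2 : m i ≤ 1 := (MvPolynomial.monomial_le_degreeOf i hm).trans (hdeg i)
  interval_cases h : m i
  · simp
  · simp
    ring

/-- A multi-linear function is affine along each coordinate direction. -/
lemma IsMultilinearFun.add_smul_baseVec (hf : IsMultilinearFun f) (x : Vec d) (i : Fin d)
    (r : ℝ) : f (x + r • baseVec i) = f x + r * fderiv ℝ f x (baseVec i) := by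
  obtain ⟨b, hb⟩ := hf.exists_affine x i
  have h1 : HasDerivAt (fun r : ℝ => x + r • (baseVec i : Vec d)) (baseVec i) 0 := by
    simpa using ((hasDerivAt_id (0 : ℝ)).smul_const (baseVec i : Vec d)).const_add x
  have h2 : HasFDerivAt f (fderiv ℝ f x) (x + (0 : ℝ) • (baseVec i : Vec d)) := by
    simpa using ((hf.contDiff.differentiable (by norm_num)) x).hasFDerivAt
  have h3 := h2.comp_hasDerivAt (0 : ℝ) h1
  have h4 : HasDerivAt (fun r : ℝ => f x + r * b) b 0 := by
    simpa using ((hasDerivAt_id (0 : ℝ)).mul_const b).const_add (f x)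
  have h5 : (f ∘ fun r : ℝ => x + r • (baseVec i : Vec d)) = fun r => f x + r * b := by
    ext r; exact hb r
  rw [h5] at h3
  rw [hb, h3.unique h4]

lemma fderiv_eq_sum (x h : Vec d) :
    fderiv ℝ f x h = ∑ i, h i * fderiv ℝ f x (baseVec i) := by
  conv_lhs => rw [← sum_smul_baseVec h]
  simp [map_sum]

end Multilinear

/-! ### Monotone DR-submodular rewards -/

section Box

variable {d : ℕ} {a : Fin d → ℝ}

lemma smul_mem_box {x : Vec d} (hx : x ∈ box a) {z : ℝ} (hz : z ∈ Set.Icc (0 : ℝ) 1) :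
    z • x ∈ box a := by
  intro i
  have h := hx i
  simp only [PiLp.smul_apply, smul_eq_mul]
  constructor
  · exact mul_nonneg hz.1 h.1
  · nlinarith [hz.1, hz.2]

lemma lt_of_mem_interior_box {x : Vec d} (hx : x ∈ interior (box a)) (i : Fin d) : x i < a i := by
  have hc : Tendsto (fun r : ℝ => x + r • (baseVec i : Vec d)) (𝓝[>] 0) (𝓝 x) := by
    have := ((by fun_prop : Continuous fun r : ℝ => x + r • (baseVec i : Vec d)).tendsto 0)
    simp only [zero_smul, add_zero] at this
    exact this.mono_left nhdsWithin_le_nhds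
  obtain ⟨r, hr, hr0⟩ := ((hc.eventually (mem_interior_iff_mem_nhds.1 hx)).and
    eventually_mem_nhdsWithin).exists
  have := (hr i).2
  simp at this
  have hr0 : 0 < r := hr0
  linarith

end Box

namespace IsMDSReward

variable {d : ℕ} {a : Fin d → ℝ} {L₁ : ℝ} {f : Vec d → ℝ}

lemma continuous (hf : IsMDSReward (box a) L₁ f) : Continuous f :=
  hf.multilinear.contDiff.continuous

lemma nonneg (hf : IsMDSReward (box a) L₁ f) {x : Vec d} (hx : x ∈ box a) : 0 ≤ f x :=
  hf.drSubmodular.nonneg x hx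

lemma le_mul_norm (hf : IsMDSReward (box a) L₁ f) (h0 : (0 : Vec d) ∈ box a) {x : Vec d}
    (hx : x ∈ box a) : f x ≤ L₁ * ‖x‖ := by
  have := hf.lipschitz x hx 0 h0
  rw [hf.map_zero, sub_zero, sub_zero] at this
  exact (le_abs_self _).trans this

lemma fderiv_baseVec_nonneg (hf : IsMDSReward (box a) L₁ f) {x : Vec d} (hx : x ∈ box a)
    {i : Fin d} (hi : x i < a i) : 0 ≤ fderiv ℝ f x (baseVec i) := by
  have hmem : x + (a i - x i) • baseVec i ∈ box a := by
    intro j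
    by_cases h : j = i
    · subst h
      have := hx j
      simp
      linarith
    · simpa [h] using hx j
  have h1 := hf.monotone _ hmem x hx fun j => by
    by_cases h : j = i
    · subst h; simp [hi.le]
    · simp [h]
  rw [hf.multilinear.add_smul_baseVec] at h1
  have : 0 < a i - x i := sub_pos.2 hi
  exact nonneg_of_mul_nonneg_right (by linarith) this

/-- By diminishing returns, the coordinatewise increments of a nonnegative step, taken one after
the other, are at most those taken at the starting point. -/
lemma le_add_fderiv (hf : IsMDSReward (box a) L₁ f) {x w : Vec d} (hx : x ∈ box a)
    (hw : ∀ i, 0 ≤ w i) (hxw : x + w ∈ box a) : f (x + w) ≤ f x + fderiv ℝ f x w := by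
  have coord : ∀ (S : Finset (Fin d)) (j : Fin d),
      (∑ i ∈ S, w i • (baseVec i : Vec d)) j = if j ∈ S then w j else 0 := by
    intro S j
    simp
  have hmem : ∀ S : Finset (Fin d), x + ∑ i ∈ S, w i • (baseVec i : Vec d) ∈ box a := by
    intro S j
    have h1 := hx j
    have h2 := hxw j
    have h3 := hw j
    rw [PiLp.add_apply] at h2 ⊢
    rw [coord]
    split_ifs <;> constructor <;> linarith
  have key : ∀ S : Finset (Fin d), f (x + ∑ i ∈ S, w i • (baseVec i : Vec d))
      ≤ f x + ∑ i ∈ S, w i * fderiv ℝ f x (baseVec i) := by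
    intro S
    induction S using Finset.induction_on with
    | empty => simp
    | insert i S hi ih =>
      have h1 : x + ∑ j ∈ insert i S, w j • (baseVec j : Vec d)
          = (x + ∑ j ∈ S, w j • (baseVec j : Vec d)) + w i • baseVec i := by
        rw [Finset.sum_insert hi]; abel
      have h2 := hf.drSubmodular.diminishing (x + ∑ j ∈ S, w j • (baseVec j : Vec d)) (hmem S) x hx
        (fun j => by
          rw [PiLp.add_apply, coord]
          have := hw j
          split_ifs <;> linarith) i (w i) (hw i) (h1 ▸ hmem (insert i S))
        (by simpa using hmem {i})
      rw [h1, Finset.sum_insert hi]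
      rw [hf.multilinear.add_smul_baseVec x i] at h2
      linarith
  have := key Finset.univ
  rwa [sum_smul_baseVec, ← fderiv_eq_sum] at this

/-- The first-order inequality of monotone DR-submodular maximization. -/
lemma sub_le_fderiv (hf : IsMDSReward (box a) L₁ f) {x y : Vec d} (hx : x ∈ box a)
    (hxa : ∀ i, x i < a i) (hy : y ∈ box a) : f y - f x ≤ fderiv ℝ f x y := by
  set w : Vec d := WithLp.toLp 2 fun i => max (y i) (x i) - x i with hw
  have hwi : ∀ i, w i = max (y i) (x i) - x i := fun i => rfl
  have hw0 : ∀ i, 0 ≤ w i := fun i => by rw [hwi]; linarith [le_max_right (y i) (x i)]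
  have hmem : x + w ∈ box a := by
    intro i
    rw [PiLp.add_apply, hwi, add_sub_cancel]
    exact ⟨(hx i).1.trans (le_max_right _ _), max_le (hy i).2 (hx i).2⟩
  have h1 := hf.le_add_fderiv hx hw0 hmem
  have h2 := hf.monotone _ hmem y hy fun i => by
    rw [PiLp.add_apply, hwi, add_sub_cancel]; exact le_max_left _ _
  have h3 : fderiv ℝ f x w ≤ fderiv ℝ f x y := by
    rw [fderiv_eq_sum x w, fderiv_eq_sum x y]
    refine Finset.sum_le_sum fun i _ =>
      mul_le_mul_of_nonneg_right ?_ (hf.fderiv_baseVec_nonneg hx (hxa i))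
    rw [hwi, sub_le_iff_le_add]
    exact max_le (by linarith [(hx i).1]) (by linarith [(hy i).1])
  linarith

/-- The boosting inequality: averaging the gradient along the segment from the origin to `x` with
the weight `e^{z-1}` makes every stationary point a `(1 - 1/e)`-approximate maximizer. -/
lemma boosting (hf : IsMDSReward (box a) L₁ f) {x y : Vec d} (hx : x ∈ box a)
    (hxa : ∀ i, x i < a i) (hy : y ∈ box a) :
    (1 - 1 / Real.exp 1) * f y - f x
      ≤ ∫ z in (0 : ℝ)..1, Real.exp (z - 1) * fderiv ℝ f (z • x) (y - x) := by
  have hdiff : Differentiable ℝ f := hf.multilinear.contDiff.differentiable (by norm_num)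
  have hcd : Continuous (fderiv ℝ f) := hf.multilinear.contDiff.continuous_fderiv (by norm_num)
  have hder : ∀ z : ℝ, HasDerivAt (fun z : ℝ => Real.exp (z - 1) * (f y - f (z • x)))
      (Real.exp (z - 1) * (f y - f (z • x)) - Real.exp (z - 1) * fderiv ℝ f (z • x) x) z := by
    intro z
    have h1 : HasDerivAt (fun z : ℝ => z • x) x z := by
      simpa using (hasDerivAt_id z).smul_const x
    have h2 := (hdiff (z • x)).hasFDerivAt.comp_hasDerivAt z h1
    have h3 : HasDerivAt (fun z : ℝ => Real.exp (z - 1)) (Real.exp (z - 1)) z := by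
      simpa using ((hasDerivAt_id z).sub_const 1).exp
    have h4 := h3.mul (h2.const_sub (f y))
    refine h4.congr_deriv ?_
    simp only [Function.comp]
    ring
  have hcont : Continuous fun z : ℝ =>
      Real.exp (z - 1) * (f y - f (z • x)) - Real.exp (z - 1) * fderiv ℝ f (z • x) x := by
    have := hf.continuous
    fun_prop
  have hint := intervalIntegral.integral_eq_sub_of_hasDerivAt (fun z _ => hder z)
    (hcont.intervalIntegrable 0 1)
  have hcont2 : Continuous fun z : ℝ => Real.exp (z - 1) * fderiv ℝ f (z • x) (y - x) := by
    fun_prop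
  have hle := intervalIntegral.integral_mono_on (μ := volume) zero_le_one
    (hcont.intervalIntegrable 0 1) (hcont2.intervalIntegrable 0 1) (fun z hz => by
      have hza : ∀ i, (z • x) i < a i := fun i => by
        simp only [PiLp.smul_apply, smul_eq_mul]
        nlinarith [hz.1, hz.2, hxa i, (hx i).1]
      have h1 := hf.sub_le_fderiv (smul_mem_box hx hz) hza hy
      rw [map_sub, mul_sub]
      have := mul_le_mul_of_nonneg_left h1 (Real.exp_pos (z - 1)).le
      linarith)
  rw [hint] at hle
  refine le_trans (le_of_eq ?_) hle
  simp only [sub_self, Real.exp_zero, one_smul, zero_smul, hf.map_zero, zero_sub, sub_zero,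
    Real.exp_neg]
  ring

end IsMDSReward

/-! ### The laws of the coins -/

section Laws

instance isProbabilityMeasure_uniformOn_fin (L : ℕ) [NeZero L] :
    IsProbabilityMeasure (uniformOn (Set.univ : Set (Fin L))) :=
  isProbabilityMeasure_uniformOn Set.finite_univ Set.univ_nonempty

lemma integral_uniformOn_fin (L : ℕ) [NeZero L] (h : Fin L → ℝ) :
    ∫ j, h j ∂(uniformOn (Set.univ : Set (Fin L))) = (L : ℝ)⁻¹ * ∑ j, h j := by
  rw [integral_fintype (Integrable.of_finite)]
  have : ∀ j : Fin L, (uniformOn (Set.univ : Set (Fin L))).real {j} = (L : ℝ)⁻¹ := by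
    intro j
    rw [Measure.real, uniformOn_univ, Measure.count_singleton]
    simp
  simp only [this, smul_eq_mul, Finset.mul_sum]

lemma one_sub_exp_neg_one_pos : 0 < 1 - Real.exp (-1) := by
  have : Real.exp (-1) < 1 := by
    rw [← Real.exp_zero]
    exact Real.exp_lt_exp.2 (by norm_num)
  linarith

lemma integral_scaleLaw (h : ℝ → ℝ) :
    ∫ z, h z ∂scaleLaw
      = ∫ z in (0 : ℝ)..1, Real.exp (z - 1) / (1 - Real.exp (-1)) * h z := by
  rw [scaleLaw, integral_withDensity_eq_integral_toReal_smul (by fun_prop) (by simp),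
    integral_Icc_eq_integral_Ioc, intervalIntegral.integral_of_le zero_le_one]
  refine integral_congr_ae (ae_of_all _ fun z => ?_)
  simp only [smul_eq_mul]
  rw [ENNReal.toReal_ofReal (div_nonneg (Real.exp_pos _).le one_sub_exp_neg_one_pos.le)]

instance isProbabilityMeasure_scaleLaw : IsProbabilityMeasure scaleLaw := by
  constructor
  have hc : Continuous fun u : ℝ => Real.exp (u - 1) / (1 - Real.exp (-1)) := by fun_prop
  have h1 : ∫ u in Set.Icc (0 : ℝ) 1, Real.exp (u - 1) / (1 - Real.exp (-1)) = 1 := by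
    rw [integral_Icc_eq_integral_Ioc, ← intervalIntegral.integral_of_le zero_le_one,
      intervalIntegral.integral_div, intervalIntegral.integral_comp_sub_right, integral_exp]
    simp [one_sub_exp_neg_one_pos.ne']
  rw [scaleLaw, withDensity_apply _ MeasurableSet.univ, Measure.restrict_univ,
    ← ofReal_integral_eq_lintegral_ofReal (hc.integrableOn_Icc) (ae_of_all _ fun u =>
      div_nonneg (Real.exp_pos _).le one_sub_exp_neg_one_pos.le), h1, ENNReal.ofReal_one]

lemma ae_mem_Icc_scaleLaw : ∀ᵐ z ∂scaleLaw, z ∈ Set.Icc (0 : ℝ) 1 :=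
  (withDensity_absolutelyContinuous _ _).ae_le (ae_restrict_mem measurableSet_Icc)

lemma ae_ne_zero_scaleLaw : ∀ᵐ z ∂scaleLaw, z ≠ 0 := by
  refine (withDensity_absolutelyContinuous _ _).ae_le (ae_restrict_of_ae ?_)
  simp [ae_iff]

lemma integral_directionLaw {d : ℕ} (h : Vec d → ℝ) :
    ∫ u, h u ∂directionLaw d = 1 / 2 * h 0 + ∑ i, 1 / (2 * (d : ℝ)) * h (baseVec i) := by
  have hint : ∀ (r : ℝ) (u : Vec d), Integrable h (ENNReal.ofReal r • Measure.dirac u) :=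
    fun r u => (integrable_dirac (by simp)).smul_measure ENNReal.ofReal_ne_top
  have hd : (0 : ℝ) ≤ 1 / (2 * (d : ℝ)) := by positivity
  rw [directionLaw, integral_add_measure (hint _ _)
    (integrable_finsetSum_measure.2 fun i _ => hint _ _), integral_finsetSum_measure
    fun i _ => hint _ _]
  simp only [integral_smul_measure, integral_dirac, smul_eq_mul]
  rw [ENNReal.toReal_ofReal (by norm_num), ENNReal.toReal_ofReal hd]

lemma isProbabilityMeasure_directionLaw {d : ℕ} (hd : 1 ≤ d) :
    IsProbabilityMeasure (directionLaw d) := by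
  constructor
  have hd' : (0 : ℝ) < d := by exact_mod_cast hd
  simp only [directionLaw, Measure.coe_add, Measure.coe_smul, Pi.add_apply, Pi.smul_apply,
    Measure.finsetSum_apply, measure_univ, smul_eq_mul, mul_one, Finset.sum_const,
    Finset.card_univ, Fintype.card_fin]
  rw [← ENNReal.ofReal_nsmul, ← ENNReal.ofReal_add (by norm_num) (by positivity),
    nsmul_eq_mul]
  have : (1 / 2 + d * (1 / (2 * (d : ℝ)))) = 1 := by field_simp; norm_num
  rw [this, ENNReal.ofReal_one]

lemma ae_directionLaw {d : ℕ} :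
    ∀ᵐ u ∂directionLaw d, u = 0 ∨ ∃ i : Fin d, u = baseVec i := by
  rw [directionLaw, ae_add_measure_iff]
  constructor
  · refine Measure.ae_smul_measure ?_ _
    rw [ae_dirac_eq]
    exact Or.inl rfl
  · rw [← Measure.sum_fintype, Measure.ae_sum_iff]
    intro i
    refine Measure.ae_smul_measure ?_ _
    rw [ae_dirac_eq]
    exact Or.inr ⟨i, rfl⟩

/-- The map of the unit sphere to itself induced by a linear isometry. -/
noncomputable def sphereMap {d : ℕ} (e : Vec d ≃ₗᵢ[ℝ] Vec d) (v : Metric.sphere (0 : Vec d) 1) :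
    Metric.sphere (0 : Vec d) 1 :=
  ⟨e v, by simp⟩

open scoped Pointwise in
lemma measurePreserving_sphereMap {d : ℕ} (e : Vec d ≃ₗᵢ[ℝ] Vec d) :
    MeasurePreserving (sphereMap e) (sphereLaw d) (sphereLaw d) := by
  have hm : Measurable (sphereMap e) :=
    (e.continuous.measurable.comp measurable_subtype_coe).subtype_mk
  have : MeasurePreserving (sphereMap e) (volume : Measure (Vec d)).toSphere
      (volume : Measure (Vec d)).toSphere := by
    refine ⟨hm, Measure.ext fun s hs => ?_⟩
    rw [Measure.map_apply hm hs, Measure.toSphere_apply' _ (hm hs), Measure.toSphere_apply' _ hs]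
    congr 1
    rw [← e.measurePreserving.measure_preimage_emb e.toHomeomorph.measurableEmbedding
      (Set.Ioo (0 : ℝ) 1 • (Subtype.val '' s))]
    congr 1
    ext x
    simp only [Set.mem_smul, Set.mem_image, Set.mem_preimage]
    constructor
    · rintro ⟨r, hr, _, ⟨v, hv, rfl⟩, rfl⟩
      exact ⟨r, hr, _, ⟨_, hv, rfl⟩, by simp [sphereMap]⟩
    · rintro ⟨r, hr, _, ⟨v, hv, rfl⟩, hx⟩
      refine ⟨r, hr, _, ⟨sphereMap e.symm v, ?_, rfl⟩, ?_⟩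
      · have : sphereMap e (sphereMap e.symm v) = v := by ext1; simp [sphereMap]
        rwa [this]
      · apply e.injective
        simpa [sphereMap] using hx
  exact this.smul_measure _

lemma isProbabilityMeasure_sphereLaw {d : ℕ} (hd : 1 ≤ d) :
    IsProbabilityMeasure (sphereLaw d) := by
  have : Nontrivial (Vec d) := ⟨⟨0, baseVec ⟨0, hd⟩, by simp [baseVec, eq_comm]⟩⟩
  constructor
  rw [sphereLaw, Measure.smul_apply, smul_eq_mul]
  exact ENNReal.inv_mul_cancel
    (Measure.measure_univ_ne_zero.2 (Measure.toSphere_ne_zero _)) (measure_ne_top _ _)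

lemma integrable_inner_mul_inner {d : ℕ} (hd : 1 ≤ d) (a b : Vec d) :
    Integrable (fun v : Metric.sphere (0 : Vec d) 1 => ⟪a, v⟫ * ⟪b, v⟫) (sphereLaw d) := by
  have := isProbabilityMeasure_sphereLaw hd
  refine Integrable.of_bound (Continuous.aestronglyMeasurable (by fun_prop)) (‖a‖ * ‖b‖)
    (ae_of_all _ fun v => ?_)
  have hv : ‖(v : Vec d)‖ = 1 := by simp
  have h1 := abs_real_inner_le_norm a (v : Vec d)
  have h2 := abs_real_inner_le_norm b (v : Vec d)
  rw [hv, mul_one] at h1 h2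
  rw [Real.norm_eq_abs, abs_mul]
  exact mul_le_mul h1 h2 (abs_nonneg _) (norm_nonneg _)

/-- The second moments of a uniform point of the sphere: by rotation invariance `E⟨a, v⟩²` depends
only on the norm of `a`, and the coordinates have squares summing to `1`. -/
lemma integral_inner_mul_inner {d : ℕ} (hd : 1 ≤ d) (a b : Vec d) :
    ∫ v, ⟪a, (v : Vec d)⟫ * ⟪b, (v : Vec d)⟫ ∂sphereLaw d = ⟪a, b⟫ / d := by
  have := isProbabilityMeasure_sphereLaw hd
  have hd' : (0 : ℝ) < d := by exact_mod_cast hd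
  set Q : Vec d → ℝ := fun a => ∫ v, ⟪a, (v : Vec d)⟫ * ⟪a, (v : Vec d)⟫ ∂sphereLaw d with hQ
  have hinv : ∀ a b : Vec d, ‖a‖ = ‖b‖ → Q a = Q b := by
    intro a b hab
    set e : Vec d ≃ₗᵢ[ℝ] Vec d := (ℝ ∙ (a - b))ᗮ.reflection with he
    have hmap : e a = b := Submodule.reflection_sub hab
    have hmp := measurePreserving_sphereMap e
    have hc : Continuous fun v : Metric.sphere (0 : Vec d) 1 =>
        ⟪b, (v : Vec d)⟫ * ⟪b, (v : Vec d)⟫ := by fun_prop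
    have h1 := integral_map (μ := sphereLaw d) hmp.measurable.aemeasurable
      (f := fun v : Metric.sphere (0 : Vec d) 1 => ⟪b, (v : Vec d)⟫ * ⟪b, (v : Vec d)⟫)
      hc.aestronglyMeasurable
    rw [hmp.map_eq] at h1
    rw [hQ]
    simp only
    rw [h1]
    refine integral_congr_ae (ae_of_all _ fun v => ?_)
    have : ⟪b, ((sphereMap e v : Metric.sphere (0 : Vec d) 1) : Vec d)⟫ = ⟪a, (v : Vec d)⟫ := by
      rw [← hmap]
      exact e.inner_map_map _ _
    simp only [this]
  have hsmul : ∀ (r : ℝ) (a : Vec d), Q (r • a) = r ^ 2 * Q a := by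
    intro r a
    simp only [hQ]
    rw [← integral_const_mul]
    refine integral_congr_ae (ae_of_all _ fun v => ?_)
    simp only [real_inner_smul_left]
    ring
  set e₀ : Vec d := baseVec ⟨0, hd⟩ with he₀
  have hnorm : ∀ i : Fin d, ‖(baseVec i : Vec d)‖ = 1 := fun i => by simp [baseVec]
  have hQn : ∀ a, Q a = ‖a‖ ^ 2 * Q e₀ := by
    intro a
    rw [← hsmul]
    exact hinv _ _ (by rw [norm_smul, hnorm]; simp)
  have hQ0 : Q e₀ = 1 / d := by
    have h1 : ∑ i : Fin d, Q (baseVec i) = 1 := by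
      simp only [hQ]
      rw [← integral_finsetSum _ fun i _ => integrable_inner_mul_inner hd _ _]
      have : ∀ v : Metric.sphere (0 : Vec d) 1,
          ∑ i : Fin d, ⟪(baseVec i : Vec d), (v : Vec d)⟫ * ⟪(baseVec i : Vec d), (v : Vec d)⟫
            = 1 := by
        intro v
        have hv : ‖(v : Vec d)‖ = 1 := by simp
        have h2 := EuclideanSpace.real_norm_sq_eq (v : Vec d)
        rw [hv] at h2
        simp only [baseVec, EuclideanSpace.inner_single_left, map_one, one_mul]
        rw [← Finset.sum_congr rfl fun i _ => sq ((v : Vec d) i), ← h2, one_pow]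
      simp [this]
    have h2 : ∀ i : Fin d, Q (baseVec i) = Q e₀ := fun i => by rw [hQn, hnorm]; ring
    simp only [h2, Finset.sum_const, Finset.card_univ, Fintype.card_fin, nsmul_eq_mul] at h1
    field_simp
    linarith
  have hpol : ∫ v, ⟪a, (v : Vec d)⟫ * ⟪b, (v : Vec d)⟫ ∂sphereLaw d
      = (Q (a + b) - Q (a - b)) / 4 := by
    simp only [hQ]
    rw [← integral_sub (integrable_inner_mul_inner hd _ _) (integrable_inner_mul_inner hd _ _),
      ← integral_div]
    refine integral_congr_ae (ae_of_all _ fun v => ?_)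
    simp only [inner_add_left, inner_sub_left]
    ring
  rw [hpol, hQn (a + b), hQn (a - b), hQ0, norm_add_sq_real, norm_sub_sq_real]
  ring

/-- The coins that occur almost surely: a scaling in `[0,1]`, and the vector `0` or a base
vector. -/
def TypicalCoins {d L : ℕ} (c : Coins d L) : Prop :=
  c.2.1 ∈ Set.Icc (0 : ℝ) 1 ∧ (c.2.2.2 = 0 ∨ ∃ i, c.2.2.2 = baseVec i)

lemma isProbabilityMeasure_coinLaw {d L : ℕ} (hd : 1 ≤ d) [NeZero L] :
    IsProbabilityMeasure (coinLaw d L) := by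
  have := isProbabilityMeasure_sphereLaw hd
  have := isProbabilityMeasure_directionLaw hd
  unfold coinLaw
  infer_instance

lemma ae_typicalCoins {d L : ℕ} (hd : 1 ≤ d) [NeZero L] :
    ∀ᵐ c ∂coinLaw d L, TypicalCoins c := by
  have := isProbabilityMeasure_sphereLaw hd
  have := isProbabilityMeasure_directionLaw hd
  have h1 : ∀ᵐ c ∂coinLaw d L, c.2.1 ∈ Set.Icc (0 : ℝ) 1 :=
    Measure.quasiMeasurePreserving_snd.ae
      (Measure.quasiMeasurePreserving_fst.ae ae_mem_Icc_scaleLaw)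
  have h2 : ∀ᵐ c ∂coinLaw d L, c.2.2.2 = 0 ∨ ∃ i, c.2.2.2 = baseVec i :=
    Measure.quasiMeasurePreserving_snd.ae (Measure.quasiMeasurePreserving_snd.ae
      (Measure.quasiMeasurePreserving_snd.ae ae_directionLaw))
  filter_upwards [h1, h2] with c hc1 hc2 using ⟨hc1, hc2⟩

end Laws

/-! ### The Dikin matrix -/

section Dikin

variable {d : ℕ}

lemma toEuclideanLin_mul (A B : Matrix (Fin d) (Fin d) ℝ) (v : Vec d) :
    Matrix.toEuclideanLin (A * B) v = Matrix.toEuclideanLin A (Matrix.toEuclideanLin B v) := by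
  simp [Matrix.toLpLin_apply, Matrix.mulVec_mulVec]

lemma toEuclideanLin_one (v : Vec d) :
    Matrix.toEuclideanLin (1 : Matrix (Fin d) (Fin d) ℝ) v = v := by
  simp

lemma inner_toEuclideanLin_left {A : Matrix (Fin d) (Fin d) ℝ} (hA : A.IsHermitian)
    (v w : Vec d) : ⟪Matrix.toEuclideanLin A v, w⟫ = ⟪v, Matrix.toEuclideanLin A w⟫ :=
  Matrix.isSymmetric_toEuclideanLin_iff.2 hA v w

namespace IsSelfConcordantBarrier

variable {K : Set (Vec d)} {ν : ℝ} {Φ : Vec d → ℝ}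

lemma inner_hessianMatrix (Φ : Vec d → ℝ) (x h : Vec d) :
    ⟪h, Matrix.toEuclideanLin (hessianMatrix Φ x) h⟫ = iteratedFDeriv ℝ 2 Φ x (fun _ => h) := by
  have e1 : iteratedFDeriv ℝ 2 Φ x (fun _ => h)
      = ∑ i, ∑ j, h i * (h j * fderiv ℝ (fderiv ℝ Φ) x (baseVec i) (baseVec j)) := by
    rw [iteratedFDeriv_two_apply]
    conv_lhs => rw [← sum_smul_baseVec h]
    simp only [map_sum, _root_.sum_apply, map_smul, _root_.smul_apply, smul_eq_mul,
      Finset.mul_sum]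
    rw [Finset.sum_comm]
    exact Finset.sum_congr rfl fun i _ => Finset.sum_congr rfl fun j _ => by ring
  rw [e1, PiLp.inner_apply]
  refine Finset.sum_congr rfl fun i _ => ?_
  simp only [Matrix.toLpLin_apply, Matrix.mulVec, dotProduct, hessianMatrix,
    Matrix.of_apply, iteratedFDeriv_two_apply, Matrix.cons_val_zero, Matrix.cons_val_one,
    RCLike.inner_apply, conj_trivial, Finset.sum_mul]
  exact Finset.sum_congr rfl fun j _ => by ring

lemma isHermitian_hessianMatrix (hΦ : IsSelfConcordantBarrier K ν Φ) {x : Vec d}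
    (hx : x ∈ interior K) : (hessianMatrix Φ x).IsHermitian := by
  ext i j
  have hs : IsSymmSndFDerivAt ℝ Φ x := (hΦ.contDiffAt hx).isSymmSndFDerivAt (by simp; norm_num)
  simp only [Matrix.conjTranspose_apply, hessianMatrix, Matrix.of_apply, star_trivial,
    iteratedFDeriv_two_apply, Matrix.cons_val_zero, Matrix.cons_val_one]
  exact hs _ _

lemma posDef_hessianMatrix (hΦ : IsSelfConcordantBarrier K ν Φ) (hK : IsCompact K) {x : Vec d}
    (hx : x ∈ interior K) : (hessianMatrix Φ x).PosDef := by
  refine Matrix.PosDef.of_dotProduct_mulVec_pos (hΦ.isHermitian_hessianMatrix hx) fun h hh => ?_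
  have h1 := inner_hessianMatrix Φ x (WithLp.toLp 2 h)
  have h2 : ⟪WithLp.toLp 2 h, Matrix.toEuclideanLin (hessianMatrix Φ x) (WithLp.toLp 2 h)⟫
      = star h ⬝ᵥ (hessianMatrix Φ x).mulVec h := by
    rw [PiLp.inner_apply]
    simp [dotProduct, mul_comm]
  rw [← h2, h1, ← hΦ.sq_localNorm hx]
  refine pow_pos (lt_of_le_of_ne (localNorm_nonneg _ _ _) fun h0 => hh ?_) 2
  have := hΦ.eq_zero_of_localNorm_eq_zero hK hx h0.symm
  simpa using this

open scoped MatrixOrder in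
lemma posSemidef_dikinMatrix (Φ : Vec d → ℝ) (x : Vec d) : (dikinMatrix Φ x).PosSemidef :=
  Matrix.nonneg_iff_posSemidef.1 (CFC.sqrt_nonneg _)

open scoped MatrixOrder in
lemma dikinMatrix_mul_self (hΦ : IsSelfConcordantBarrier K ν Φ) (hK : IsCompact K) {x : Vec d}
    (hx : x ∈ interior K) :
    dikinMatrix Φ x * dikinMatrix Φ x = (hessianMatrix Φ x)⁻¹ :=
  CFC.sqrt_mul_sqrt_self _
    (Matrix.nonneg_iff_posSemidef.2 (hΦ.posDef_hessianMatrix hK hx).inv.posSemidef)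

lemma isUnit_dikinMatrix (hΦ : IsSelfConcordantBarrier K ν Φ) (hK : IsCompact K) {x : Vec d}
    (hx : x ∈ interior K) : IsUnit (dikinMatrix Φ x).det := by
  have h1 := (hΦ.posDef_hessianMatrix hK hx).inv.isUnit
  rw [← hΦ.dikinMatrix_mul_self hK hx, Matrix.isUnit_iff_isUnit_det, Matrix.det_mul] at h1
  exact isUnit_of_mul_isUnit_left h1

/-- The local norm is the Euclidean norm after applying `H⁻¹`. -/
lemma localNorm_eq_norm (hΦ : IsSelfConcordantBarrier K ν Φ) (hK : IsCompact K) {x : Vec d}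
    (hx : x ∈ interior K) (h : Vec d) :
    localNorm Φ x h = ‖Matrix.toEuclideanLin (dikinMatrix Φ x)⁻¹ h‖ := by
  have h1 : hessianMatrix Φ x = (dikinMatrix Φ x)⁻¹ * (dikinMatrix Φ x)⁻¹ := by
    rw [← Matrix.mul_inv_rev, hΦ.dikinMatrix_mul_self hK hx, Matrix.nonsing_inv_nonsing_inv]
    exact (Matrix.isUnit_iff_isUnit_det _).1 (hΦ.posDef_hessianMatrix hK hx).isUnit
  have h2 := inner_hessianMatrix Φ x h
  rw [h1, toEuclideanLin_mul, ← inner_toEuclideanLin_left (posSemidef_dikinMatrix Φ x).1.inv,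
    real_inner_self_eq_norm_sq, ← hΦ.sq_localNorm hx] at h2
  exact ((sq_eq_sq₀ (norm_nonneg _) (localNorm_nonneg _ _ _)).1 h2).symm

lemma dikinMatrix_inv_apply (hΦ : IsSelfConcordantBarrier K ν Φ) (hK : IsCompact K) {x : Vec d}
    (hx : x ∈ interior K) (v : Vec d) :
    Matrix.toEuclideanLin (dikinMatrix Φ x)⁻¹ (Matrix.toEuclideanLin (dikinMatrix Φ x) v) = v := by
  rw [← toEuclideanLin_mul, Matrix.nonsing_inv_mul _ (hΦ.isUnit_dikinMatrix hK hx),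
    toEuclideanLin_one]

lemma dikinMatrix_apply_inv (hΦ : IsSelfConcordantBarrier K ν Φ) (hK : IsCompact K) {x : Vec d}
    (hx : x ∈ interior K) (v : Vec d) :
    Matrix.toEuclideanLin (dikinMatrix Φ x) (Matrix.toEuclideanLin (dikinMatrix Φ x)⁻¹ v) = v := by
  rw [← toEuclideanLin_mul, Matrix.mul_nonsing_inv _ (hΦ.isUnit_dikinMatrix hK hx),
    toEuclideanLin_one]

/-- A Dikin step from an interior point stays in `K`. -/
lemma add_dikinStep_mem (hΦ : IsSelfConcordantBarrier K ν Φ) (hK : IsCompact K) {L : ℕ}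
    {x : Vec d} (hx : x ∈ interior K) (c : Coins d L) :
    x + BanditMLSM.dikinStep Φ x c ∈ K := by
  refine hΦ.add_mem hK.isClosed hx ?_
  rw [hΦ.localNorm_eq_norm hK hx, BanditMLSM.dikinStep, hΦ.dikinMatrix_inv_apply hK hx]
  simp

end IsSelfConcordantBarrier

end Dikin

/-! ### The exploration round -/

namespace BanditMLSM

variable {d L : ℕ} {K : Set (Vec d)} {ν D L₁ : ℝ} {Φ : Vec d → ℝ} {a : Fin d → ℝ}

lemma exploreAction_zero (x : Vec d) (t : Fin L) (z : ℝ) (v : Metric.sphere (0 : Vec d) 1) :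
    exploreAction Φ x (t, z, v, (0 : Vec d)) = z • x := by
  simp [exploreAction]

lemma exploreAction_baseVec (x : Vec d) (t : Fin L) (z : ℝ) (v : Metric.sphere (0 : Vec d) 1)
    (i : Fin d) :
    exploreAction Φ x (t, z, v, (baseVec i : Vec d))
      = z • x + (z * Matrix.toEuclideanLin (dikinMatrix Φ x) v i) • baseVec i := by
  simp [exploreAction, dikinStep, baseVec, EuclideanSpace.inner_single_right]

lemma exists_exploreAction_eq_smul (hΦ : IsSelfConcordantBarrier K ν Φ) (hK : IsCompact K)
    (hKD : K ⊆ Metric.closedBall 0 D) (hKa : K ⊆ box a) {x : Vec d} (hx : x ∈ interior K)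
    {c : Coins d L} (hc : TypicalCoins c) :
    ∃ y ∈ box a, ‖y‖ ≤ 2 * D ∧ exploreAction Φ x c = c.2.1 • y := by
  have hxK := interior_subset hx
  have hnorm : ∀ y ∈ K, ‖y‖ ≤ D := fun y hy => by simpa using hKD hy
  obtain ⟨t, z, v, u⟩ := c
  obtain ⟨-, hu | ⟨i, hu⟩⟩ := hc
  · simp only at hu
    subst hu
    exact ⟨x, hKa hxK, by linarith [hnorm x hxK, norm_nonneg x], exploreAction_zero ..⟩
  · simp only at hu
    subst hu
    set s := Matrix.toEuclideanLin (dikinMatrix Φ x) (v : Vec d) with hs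
    have hmem : x + s ∈ K := hΦ.add_dikinStep_mem hK hx (t, z, v, (baseVec i : Vec d))
    have h1 := hKa hmem i
    have h2 := hKa hxK i
    have h3 : (x + s) i ≤ D :=
      (le_abs_self _).trans ((PiLp.norm_apply_le (x + s) i).trans (hnorm _ hmem))
    have h4 : x i ≤ D := (le_abs_self _).trans ((PiLp.norm_apply_le x i).trans (hnorm _ hxK))
    rw [PiLp.add_apply] at h1 h3
    refine ⟨x + s i • baseVec i, fun j => ?_, ?_, ?_⟩
    · by_cases hj : j = i
      · subst hj
        simpa using h1
      · simpa [hj] using hKa hxK j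
    · refine (norm_add_le _ _).trans ?_
      have : |s i| ≤ D := abs_le.2 ⟨by linarith, by linarith⟩
      have hb : ‖(baseVec i : Vec d)‖ = 1 := by simp [baseVec]
      rw [norm_smul, hb, mul_one, Real.norm_eq_abs]
      linarith [hnorm x hxK]
    · rw [exploreAction_baseVec, smul_add, smul_smul]

lemma exploreAction_mem_box (hΦ : IsSelfConcordantBarrier K ν Φ) (hK : IsCompact K)
    (hKD : K ⊆ Metric.closedBall 0 D) (hKa : K ⊆ box a) {x : Vec d} (hx : x ∈ interior K)
    {c : Coins d L} (hc : TypicalCoins c) : exploreAction Φ x c ∈ box a := by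
  obtain ⟨y, hy, -, h⟩ := exists_exploreAction_eq_smul hΦ hK hKD hKa hx hc
  rw [h]
  exact smul_mem_box hy hc.1

lemma inner_gradEstimate (Φ : Vec d → ℝ) (x w : Vec d) (c : Coins d L) (r : ℝ) :
    ⟪gradEstimate Φ x c r, w⟫
      = d * linearEstimate c r * ⟪Matrix.toEuclideanLin (dikinMatrix Φ x)⁻¹ c.2.2.1, w⟫ := by
  rw [gradEstimate, real_inner_smul_left]

lemma one_sub_exp_mem : 1 - 1 / Real.exp 1 ∈ Set.Icc (0 : ℝ) 1 := by
  have h := one_sub_exp_neg_one_pos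
  rw [Real.exp_neg, ← one_div] at h
  exact ⟨h.le, by linarith [one_div_pos.2 (Real.exp_pos 1)]⟩

/-- The division by `z` in the estimate is harmless: the reward of the played action is at most
proportional to `z`. -/
lemma abs_linearEstimate_le (hΦ : IsSelfConcordantBarrier K ν Φ) (hK : IsCompact K)
    (hKD : K ⊆ Metric.closedBall 0 D) (hKa : K ⊆ box a) (h0 : (0 : Vec d) ∈ K) (hL₁ : 0 ≤ L₁)
    {x : Vec d} (hx : x ∈ interior K) {c : Coins d L} (hc : TypicalCoins c) {f : Vec d → ℝ}
    (hf : IsMDSReward (box a) L₁ f) :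
    |linearEstimate c (f (exploreAction Φ x c))| ≤ 4 * d * (L₁ * D) := by
  obtain ⟨y, hy, hyD, h⟩ := exists_exploreAction_eq_smul hΦ hK hKD hKa hx hc
  have hbox := smul_mem_box hy hc.1
  have hfn := hf.nonneg hbox
  have hfl := hf.le_mul_norm (hKa h0) hbox
  rw [h]
  have hD : 0 ≤ D := by linarith [norm_nonneg y]
  have hα := one_sub_exp_mem
  by_cases hz : c.2.1 = 0
  · rw [linearEstimate, if_pos hz, abs_zero]
    positivity
  · have hzpos : 0 < c.2.1 := lt_of_le_of_ne hc.1.1 (Ne.symm hz)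
    have habs : |linearEstimate c (f (c.2.1 • y))|
        = 2 * (1 - 1 / Real.exp 1) * (d / c.2.1) * f (c.2.1 • y) := by
      have hnn : 0 ≤ 2 * (1 - 1 / Real.exp 1) * (d / c.2.1) * f (c.2.1 • y) :=
        mul_nonneg (mul_nonneg (mul_nonneg zero_le_two hα.1)
          (div_nonneg (Nat.cast_nonneg d) hzpos.le)) hfn
      rw [linearEstimate, if_neg hz]
      split_ifs
      · rw [abs_neg, abs_of_nonneg hnn]
      · rw [abs_of_nonneg hnn]
    rw [norm_smul, Real.norm_eq_abs, abs_of_pos hzpos] at hfl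
    have h5 : f (c.2.1 • y) ≤ c.2.1 * (2 * (L₁ * D)) := by
      refine hfl.trans ?_
      have := mul_le_mul_of_nonneg_left hyD (mul_nonneg hL₁ hzpos.le)
      linarith
    rw [habs]
    calc 2 * (1 - 1 / Real.exp 1) * (d / c.2.1) * f (c.2.1 • y)
        ≤ 2 * 1 * (d / c.2.1) * (c.2.1 * (2 * (L₁ * D))) := by
          have := hα.2
          gcongr
      _ = 4 * d * (L₁ * D) := by field_simp; ring

/-- The dual local norm of the gradient estimate is bounded uniformly in the current point. -/
lemma abs_inner_gradEstimate_le (hΦ : IsSelfConcordantBarrier K ν Φ) (hK : IsCompact K)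
    (hKD : K ⊆ Metric.closedBall 0 D) (hKa : K ⊆ box a) (h0 : (0 : Vec d) ∈ K) (hL₁ : 0 ≤ L₁)
    {x : Vec d} (hx : x ∈ interior K) {c : Coins d L} (hc : TypicalCoins c) {f : Vec d → ℝ}
    (hf : IsMDSReward (box a) L₁ f) (w : Vec d) :
    |⟪gradEstimate Φ x c (f (exploreAction Φ x c)), w⟫|
      ≤ 4 * d ^ 2 * (L₁ * D) * localNorm Φ x w := by
  rw [inner_gradEstimate, abs_mul, abs_mul, Nat.abs_cast]
  have h1 := abs_linearEstimate_le hΦ hK hKD hKa h0 hL₁ hx hc hf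
  have h2 : |⟪Matrix.toEuclideanLin (dikinMatrix Φ x)⁻¹ c.2.2.1, w⟫| ≤ localNorm Φ x w := by
    rw [inner_toEuclideanLin_left (IsSelfConcordantBarrier.posSemidef_dikinMatrix Φ x).1.inv,
      hΦ.localNorm_eq_norm hK hx]
    refine (abs_real_inner_le_norm _ _).trans ?_
    simp
  calc d * |linearEstimate c (f (exploreAction Φ x c))|
        * |⟪Matrix.toEuclideanLin (dikinMatrix Φ x)⁻¹ c.2.2.1, w⟫|
      ≤ d * (4 * d * (L₁ * D)) * localNorm Φ x w := by
        gcongr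
        exact mul_nonneg (Nat.cast_nonneg d) ((abs_nonneg _).trans h1)
    _ = 4 * d ^ 2 * (L₁ * D) * localNorm Φ x w := by ring

/-- Averaging the estimate over `u` gives the exact directional derivative, because a multi-linear
function is affine along the coordinate directions. -/
lemma integral_linearEstimate (hd : 1 ≤ d) {f : Vec d → ℝ} (hf : IsMultilinearFun f) (x : Vec d)
    (t : Fin L) {z : ℝ} (hz : z ≠ 0) (v : Metric.sphere (0 : Vec d) 1) :
    ∫ u, linearEstimate (t, z, v, u) (f (exploreAction Φ x (t, z, v, u))) ∂directionLaw d
      = (1 - 1 / Real.exp 1)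
        * fderiv ℝ f (z • x) (Matrix.toEuclideanLin (dikinMatrix Φ x) v) := by
  have hd' : (0 : ℝ) < d := by exact_mod_cast hd
  have hb : ∀ i : Fin d, (baseVec i : Vec d) ≠ 0 := fun i => by simp [baseVec]
  rw [integral_directionLaw]
  simp only [exploreAction_zero, exploreAction_baseVec, linearEstimate, hz, hb, if_false, if_true,
    hf.add_smul_baseVec]
  rw [fderiv_eq_sum (z • x)]
  set s := Matrix.toEuclideanLin (dikinMatrix Φ x) (v : Vec d)
  have h1 : ∀ i : Fin d, 1 / (2 * (d : ℝ)) * (2 * (1 - 1 / Real.exp 1) * (d / z)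
      * (f (z • x) + z * s i * fderiv ℝ f (z • x) (baseVec i)))
      = (1 - 1 / Real.exp 1) / z * f (z • x)
        + (1 - 1 / Real.exp 1) * (s i * fderiv ℝ f (z • x) (baseVec i)) := by
    intro i
    field_simp
  simp only [h1, Finset.sum_add_distrib, Finset.sum_const, Finset.card_univ, Fintype.card_fin,
    ← Finset.mul_sum, nsmul_eq_mul]
  field_simp
  ring

end BanditMLSM

/-! ### Measurability of the algorithm -/

section Measurability

variable {d : ℕ} {α : Type*} [MeasurableSpace α]

lemma measurable_matrix_inv {A : α → Matrix (Fin d) (Fin d) ℝ}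
    (hA : ∀ i j, Measurable fun a => A a i j) (i j : Fin d) : Measurable fun a => (A a)⁻¹ i j := by
  have hm : Measurable fun a => (fun i j => A a i j : Fin d → Fin d → ℝ) :=
    measurable_pi_lambda _ fun i => measurable_pi_lambda _ fun j => hA i j
  have hid : Continuous fun B : Fin d → Fin d → ℝ => (Matrix.of B : Matrix (Fin d) (Fin d) ℝ) :=
    continuous_id
  have h1 : Measurable fun a => (A a).det := (hid.matrix_det).measurable.comp hm
  have h2 : Measurable fun a => (A a).adjugate i j :=
    ((hid.matrix_adjugate).matrix_elem i j).measurable.comp hm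
  have h3 : ∀ a, (A a)⁻¹ i j = (A a).det⁻¹ * (A a).adjugate i j := fun a => by
    rw [Matrix.inv_def, Ring.inverse_eq_inv', Matrix.smul_apply, smul_eq_mul]
  simp only [h3]
  exact h1.inv.mul h2

lemma isClosed_posSemidef :
    IsClosed {B : Fin d → Fin d → ℝ | (Matrix.of B : Matrix (Fin d) (Fin d) ℝ).PosSemidef} := by
  have : {B : Fin d → Fin d → ℝ | (Matrix.of B : Matrix (Fin d) (Fin d) ℝ).PosSemidef}
      = (⋂ i, ⋂ j, {B | B j i = B i j}) ∩
        ⋂ x : Fin d → ℝ, {B | 0 ≤ ∑ i, x i * ∑ j, B i j * x j} := by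
    ext B
    simp only [Set.mem_ofPred_eq, Matrix.posSemidef_iff_dotProduct_mulVec, Set.mem_inter_iff,
      Set.mem_iInter]
    refine and_congr ⟨fun h i j => ?_, fun h => ?_⟩ Iff.rfl
    · simpa using congrFun (congrFun h i) j
    · ext i j
      simpa using h i j
  rw [this]
  refine IsClosed.inter (isClosed_iInter fun i => isClosed_iInter fun j =>
    isClosed_eq (by fun_prop) (by fun_prop)) (isClosed_iInter fun x =>
    isClosed_le (by fun_prop) (by fun_prop))

open scoped MatrixOrder in
/-- The matrix square root is measurable, being the inverse of the squaring map, which is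
continuous and injective on positive semidefinite matrices. -/
lemma measurable_matrix_sqrt {A : α → Matrix (Fin d) (Fin d) ℝ}
    (hA : ∀ i j, Measurable fun a => A a i j) (hpos : ∀ a, (A a).PosSemidef) (i j : Fin d) :
    Measurable fun a => CFC.sqrt (A a) i j := by
  set S : Set (Fin d → Fin d → ℝ) :=
    {B | (Matrix.of B : Matrix (Fin d) (Fin d) ℝ).PosSemidef} with hS
  have hemb : MeasurableEmbedding
      (S.domRestrict fun (B : Fin d → Fin d → ℝ) (i j : Fin d) => ∑ k, B i k * B k j) := by
    refine ContinuousOn.measurableEmbedding isClosed_posSemidef.measurableSet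
      (Continuous.continuousOn (by fun_prop)) fun B hB B' hB' h => ?_
    have h1 : (Matrix.of B * Matrix.of B : Matrix (Fin d) (Fin d) ℝ)
        = Matrix.of B' * Matrix.of B' := h
    have h2 := CFC.sqrt_mul_self (Matrix.of B) (Matrix.nonneg_iff_posSemidef.2 hB)
    rw [h1, CFC.sqrt_mul_self (Matrix.of B') (Matrix.nonneg_iff_posSemidef.2 hB')] at h2
    exact h2.symm
  have hmem : ∀ a, (fun i j => CFC.sqrt (A a) i j : Fin d → Fin d → ℝ) ∈ S := fun a =>
    Matrix.nonneg_iff_posSemidef.1 (CFC.sqrt_nonneg (A a))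
  have h3 : Measurable fun a => (⟨_, hmem a⟩ : S) := by
    rw [← hemb.measurable_comp_iff]
    have : (S.domRestrict fun (B : Fin d → Fin d → ℝ) (i j : Fin d) => ∑ k, B i k * B k j) ∘
        (fun a => (⟨_, hmem a⟩ : S)) = fun a i j => A a i j := by
      ext a i j
      exact congrFun (congrFun (CFC.sqrt_mul_sqrt_self (A a)
        (Matrix.nonneg_iff_posSemidef.2 (hpos a))) i) j
    rw [this]
    exact measurable_pi_lambda _ fun i => measurable_pi_lambda _ fun j => hA i j
  have h4 := measurable_subtype_coe.comp h3
  exact (measurable_pi_iff.1 (measurable_pi_iff.1 h4 i)) j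

lemma measurable_toEuclideanLin {A : α → Matrix (Fin d) (Fin d) ℝ}
    (hA : ∀ i j, Measurable fun a => A a i j) {v : α → Vec d} (hv : Measurable v) :
    Measurable fun a => Matrix.toEuclideanLin (A a) (v a) := by
  have hvi : ∀ i, Measurable fun a => v a i := fun i =>
    (by fun_prop : Continuous fun x : Vec d => x i).measurable.comp hv
  refine (WithLp.measurable_toLp 2 (Fin d → ℝ)).comp (measurable_pi_lambda _ fun i => ?_)
  change Measurable fun a => ∑ j, A a i j * v a j
  exact Finset.measurable_fun_sum _ fun j _ => (hA i j).mul (hvi j)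

variable {K : Set (Vec d)} {ν : ℝ} {Φ : Vec d → ℝ}

lemma ContinuousOn.measurable_comp {β : Type*} [TopologicalSpace β] [MeasurableSpace β]
    [BorelSpace β] {g : β → ℝ} {s : Set β} (hg : ContinuousOn g s) {X : α → β}
    (hX : Measurable X) (hXs : ∀ a, X a ∈ s) : Measurable fun a => g (X a) :=
  (continuousOn_iff_continuous_domRestrict.1 hg).measurable.comp (hX.subtype_mk (h := hXs))

lemma continuousOn_hessianMatrix (hΦ : IsSelfConcordantBarrier K ν Φ) (i j : Fin d) :
    ContinuousOn (fun x => hessianMatrix Φ x i j) (interior K) := by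
  intro x hx
  have h1 : ContinuousAt (iteratedFDeriv ℝ 2 Φ) x :=
    (hΦ.contDiffAt hx).continuousAt_iteratedFDeriv (by norm_num)
  have h2 : Continuous fun m : ContinuousMultilinearMap ℝ (fun _ : Fin 2 => Vec d) ℝ =>
      m ![baseVec i, baseVec j] :=
    (ContinuousMultilinearMap.apply ℝ (fun _ : Fin 2 => Vec d) ℝ _).continuous
  exact (h2.continuousAt.comp h1).continuousWithinAt

lemma measurable_dikinMatrix (hΦ : IsSelfConcordantBarrier K ν Φ) (hK : IsCompact K)
    {X : α → Vec d} (hX : Measurable X) (hXK : ∀ a, X a ∈ interior K) (i j : Fin d) :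
    Measurable fun a => dikinMatrix Φ (X a) i j := by
  have hm : ∀ i j, Measurable fun a => hessianMatrix Φ (X a) i j := fun i j =>
    (continuousOn_hessianMatrix hΦ i j).measurable_comp hX hXK
  unfold dikinMatrix
  exact measurable_matrix_sqrt (A := fun a => (hessianMatrix Φ (X a))⁻¹)
    (measurable_matrix_inv hm) (fun a => (hΦ.posDef_hessianMatrix hK (hXK a)).inv.posSemidef) i j

namespace BanditMLSM

/-- The regularized leader is a measurable function of the accumulated gradient, since it inverts
the gradient of the barrier, which is continuous and injective. -/
lemma measurable_rftlPoint (hΦ : IsSelfConcordantBarrier K ν Φ) (hK : IsCompact K) (η : ℝ) :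
    Measurable (rftlPoint K Φ η) := by
  have hc : ContinuousOn (fderiv ℝ Φ) (interior K) :=
    hΦ.contDiffOn.continuousOn_fderiv_of_isOpen isOpen_interior (by norm_num)
  have hemb := hc.measurableEmbedding isOpen_interior.measurableSet (hΦ.fderiv_injOn hK)
  have h1 : Measurable fun G => (⟨_, hΦ.rftlPoint_mem hK η G⟩ : interior K) := by
    rw [← hemb.measurable_comp_iff]
    have : (interior K).domRestrict (fderiv ℝ Φ) ∘
        (fun G => (⟨_, hΦ.rftlPoint_mem hK η G⟩ : interior K)) = fun G => η • innerSL ℝ G := by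
      ext G h
      exact hΦ.fderiv_rftlPoint hK η G h
    rw [this]
    exact (by fun_prop : Continuous fun G : Vec d => η • innerSL ℝ G).measurable
  exact measurable_subtype_coe.comp h1

variable {L : ℕ}

lemma measurable_exploreAction (hΦ : IsSelfConcordantBarrier K ν Φ) (hK : IsCompact K)
    {X : α → Vec d} (hX : Measurable X) (hXK : ∀ a, X a ∈ interior K)
    {C : α → Coins d L} (hC : Measurable C) :
    Measurable fun a => exploreAction Φ (X a) (C a) := by
  have hz : Measurable fun a => (C a).2.1 := hC.snd.fst
  have hv : Measurable fun a => ((C a).2.2.1 : Vec d) :=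
    measurable_subtype_coe.comp hC.snd.snd.fst
  have hu : Measurable fun a => (C a).2.2.2 := hC.snd.snd.snd
  have hs : Measurable fun a => dikinStep Φ (X a) (C a) :=
    measurable_toEuclideanLin (measurable_dikinMatrix hΦ hK hX hXK) hv
  exact (hz.smul hX).add ((hz.mul (hs.inner hu)).smul hu)

lemma measurable_gradEstimate (hΦ : IsSelfConcordantBarrier K ν Φ) (hK : IsCompact K)
    {X : α → Vec d} (hX : Measurable X) (hXK : ∀ a, X a ∈ interior K)
    {C : α → Coins d L} (hC : Measurable C) {F : Fin L → Vec d → ℝ} (hF : ∀ j, Measurable (F j)) :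
    Measurable fun a => gradEstimate Φ (X a) (C a) (F (C a).1 (exploreAction Φ (X a) (C a))) := by
  have hz : Measurable fun a => (C a).2.1 := hC.snd.fst
  have hv : Measurable fun a => ((C a).2.2.1 : Vec d) :=
    measurable_subtype_coe.comp hC.snd.snd.fst
  have hu : Measurable fun a => (C a).2.2.2 := hC.snd.snd.snd
  have hF' : Measurable (Function.uncurry F) := measurable_from_prod_countable_right hF
  have hr : Measurable fun a => F (C a).1 (exploreAction Φ (X a) (C a)) :=
    hF'.comp (hC.fst.prodMk (measurable_exploreAction hΦ hK hX hXK hC))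
  have hl : Measurable fun a =>
      linearEstimate (C a) (F (C a).1 (exploreAction Φ (X a) (C a))) := by
    have h1 := ((hz.const_div (d : ℝ)).const_mul (2 * (1 - 1 / Real.exp 1))).mul hr
    exact Measurable.ite (hz (measurableSet_singleton 0)) measurable_const
      (Measurable.ite (hu (measurableSet_singleton 0)) h1.neg h1)
  exact (hl.const_mul (d : ℝ)).smul (measurable_toEuclideanLin
    (measurable_matrix_inv (measurable_dikinMatrix hΦ hK hX hXK)) hv)

end BanditMLSM

end Measurability

/-! ### The expected gradient estimate -/

namespace BanditMLSM

variable {d L : ℕ} {K : Set (Vec d)} {ν D L₁ : ℝ} {Φ : Vec d → ℝ} {a : Fin d → ℝ}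

lemma integrable_inner_gradEstimate [NeZero L] (hd : 1 ≤ d)
    (hΦ : IsSelfConcordantBarrier K ν Φ) (hK : IsCompact K)
    (hKD : K ⊆ Metric.closedBall 0 D) (hKa : K ⊆ box a) (h0 : (0 : Vec d) ∈ K) (hL₁ : 0 ≤ L₁)
    {x : Vec d} (hx : x ∈ interior K) {F : Fin L → Vec d → ℝ}
    (hF : ∀ j, IsMDSReward (box a) L₁ (F j)) (w : Vec d) :
    Integrable (fun c : Coins d L => ⟪gradEstimate Φ x c (F c.1 (exploreAction Φ x c)), w⟫)
      (coinLaw d L) := by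
  have := isProbabilityMeasure_coinLaw (L := L) hd
  have hm := measurable_gradEstimate (α := Coins d L) hΦ hK measurable_const (fun _ => hx)
    measurable_id (fun j => (hF j).continuous.measurable)
  refine Integrable.of_bound (hm.inner measurable_const).aestronglyMeasurable
    (4 * d ^ 2 * (L₁ * D) * localNorm Φ x w) ?_
  filter_upwards [ae_typicalCoins hd] with c hc
  exact abs_inner_gradEstimate_le hΦ hK hKD hKa h0 hL₁ hx hc (hF c.1) w

lemma integral_sphere_inner_gradEstimate (hd : 1 ≤ d)
    (hΦ : IsSelfConcordantBarrier K ν Φ) (hK : IsCompact K) {x : Vec d} (hx : x ∈ interior K)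
    {f : Vec d → ℝ} (hf : IsMultilinearFun f) (w : Vec d) (t : Fin L) {z : ℝ} (hz : z ≠ 0) :
    ∫ v, ∫ u, ⟪gradEstimate Φ x (t, z, v, u) (f (exploreAction Φ x (t, z, v, u))), w⟫
        ∂directionLaw d ∂sphereLaw d
      = (1 - 1 / Real.exp 1) * fderiv ℝ f (z • x) w := by
  have hd' : (d : ℝ) ≠ 0 := by positivity
  set H := dikinMatrix Φ x with hH
  have hHh : H.IsHermitian := (IsSelfConcordantBarrier.posSemidef_dikinMatrix Φ x).1
  set g : Vec d := (InnerProductSpace.toDual ℝ (Vec d)).symm (fderiv ℝ f (z • x)) with hg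
  have hgi : ∀ h, fderiv ℝ f (z • x) h = ⟪g, h⟫ := fun h => by
    rw [hg, InnerProductSpace.toDual_symm_apply]
  have h1 : ∀ v : Metric.sphere (0 : Vec d) 1,
      ∫ u, ⟪gradEstimate Φ x (t, z, v, u) (f (exploreAction Φ x (t, z, v, u))), w⟫ ∂directionLaw d
        = d * (1 - 1 / Real.exp 1) * (⟪Matrix.toEuclideanLin H g, (v : Vec d)⟫
          * ⟪Matrix.toEuclideanLin H⁻¹ w, (v : Vec d)⟫) := by
    intro v
    simp only [inner_gradEstimate]
    rw [integral_mul_const, integral_const_mul, integral_linearEstimate hd hf x t hz v, hgi,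
      ← inner_toEuclideanLin_left hHh, inner_toEuclideanLin_left hHh.inv,
      real_inner_comm (Matrix.toEuclideanLin H⁻¹ w)]
    ring
  simp only [h1]
  rw [integral_const_mul, integral_inner_mul_inner hd, inner_toEuclideanLin_left hHh,
    hΦ.dikinMatrix_apply_inv hK hx, hgi]
  field_simp

/-- Over one block the gradient estimate is an unbiased estimate of the gradient of the boosted
average reward of the block. -/
lemma integral_inner_gradEstimate [NeZero L] (hd : 1 ≤ d)
    (hΦ : IsSelfConcordantBarrier K ν Φ) (hK : IsCompact K)
    (hKD : K ⊆ Metric.closedBall 0 D) (hKa : K ⊆ box a) (h0 : (0 : Vec d) ∈ K) (hL₁ : 0 ≤ L₁)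
    {x : Vec d} (hx : x ∈ interior K) {F : Fin L → Vec d → ℝ}
    (hF : ∀ j, IsMDSReward (box a) L₁ (F j)) (w : Vec d) :
    ∫ c, ⟪gradEstimate Φ x c (F c.1 (exploreAction Φ x c)), w⟫ ∂coinLaw d L
      = (L : ℝ)⁻¹ * ∑ j, ∫ z in (0 : ℝ)..1, Real.exp (z - 1) * fderiv ℝ (F j) (z • x) w := by
  have := isProbabilityMeasure_sphereLaw hd
  have := isProbabilityMeasure_directionLaw hd
  have hint := integrable_inner_gradEstimate hd hΦ hK hKD hKa h0 hL₁ hx hF w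
  rw [coinLaw] at hint ⊢
  rw [integral_prod _ hint, ← integral_uniformOn_fin]
  refine integral_congr_ae ?_
  filter_upwards [hint.prod_right_ae] with t hint1
  rw [integral_prod _ hint1]
  have h1 : ∀ᵐ z ∂scaleLaw,
      ∫ p, ⟪gradEstimate Φ x (t, z, p) (F t (exploreAction Φ x (t, z, p))), w⟫
        ∂(sphereLaw d).prod (directionLaw d)
        = (1 - 1 / Real.exp 1) * fderiv ℝ (F t) (z • x) w := by
    filter_upwards [hint1.prod_right_ae, ae_ne_zero_scaleLaw] with z hint2 hz
    rw [integral_prod _ hint2]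
    exact integral_sphere_inner_gradEstimate hd hΦ hK hx (hF t).multilinear w t hz
  rw [integral_congr_ae h1, integral_scaleLaw]
  refine intervalIntegral.integral_congr fun z _ => ?_
  have h2 := one_sub_exp_neg_one_pos.ne'
  have h3 : 1 - 1 / Real.exp 1 = 1 - Real.exp (-1) := by rw [Real.exp_neg, one_div]
  simp only [h3]
  field_simp

/-- The expected regret of the point `x` during one block is at most that of the linear rewards
given by the gradient estimate. -/
lemma sum_sub_le_integral_inner_gradEstimate [NeZero L] (hd : 1 ≤ d)
    (hΦ : IsSelfConcordantBarrier K ν Φ) (hK : IsCompact K)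
    (hKD : K ⊆ Metric.closedBall 0 D) (hKa : K ⊆ box a) (h0 : (0 : Vec d) ∈ K) (hL₁ : 0 ≤ L₁)
    {x y : Vec d} (hx : x ∈ interior K) (hy : y ∈ K) {F : Fin L → Vec d → ℝ}
    (hF : ∀ j, IsMDSReward (box a) L₁ (F j)) :
    ∑ j, ((1 - 1 / Real.exp 1) * F j y - F j x)
      ≤ L * ∫ c, ⟪gradEstimate Φ x c (F c.1 (exploreAction Φ x c)), y - x⟫ ∂coinLaw d L := by
  have hL : (L : ℝ) ≠ 0 := by exact_mod_cast NeZero.ne L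
  rw [integral_inner_gradEstimate hd hΦ hK hKD hKa h0 hL₁ hx hF, mul_inv_cancel_left₀ hL]
  exact Finset.sum_le_sum fun j _ => (hF j).boosting (hKa (interior_subset hx))
    (lt_of_mem_interior_box (interior_mono hKa hx)) (hKa hy)

end BanditMLSM

/-! ### The random iterates -/

namespace BanditMLSM

variable {d L : ℕ} {K : Set (Vec d)} {ν η D L₁ : ℝ} {Φ : Vec d → ℝ} {a : Fin d → ℝ}
  {f : ℕ → Vec d → ℝ} {T : ℕ}

/-- The gradient estimate of block `q`. -/
noncomputable def blockEstimate (K : Set (Vec d)) (Φ : Vec d → ℝ) (η : ℝ) (f : ℕ → Vec d → ℝ)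
    (c : ℕ → Coins d L) (q : ℕ) : Vec d :=
  gradEstimate Φ (iterate K Φ η f c q) (c q)
    (f (q * L + (c q).1) (exploreAction Φ (iterate K Φ η f c q) (c q)))

lemma gradSum_eq_sum (c : ℕ → Coins d L) (q : ℕ) :
    gradSum K Φ η f c q = ∑ s ∈ Finset.range q, blockEstimate K Φ η f c s := by
  induction q with
  | zero => rfl
  | succ q ih => rw [Finset.sum_range_succ, ← ih]; rfl

lemma round_lt {q : ℕ} (hq : (q + 1) * L ≤ T) (j : Fin L) : q * L + j < T := by
  have := j.2
  rw [add_mul, one_mul] at hq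
  omega

lemma iterate_mem (hΦ : IsSelfConcordantBarrier K ν Φ) (hK : IsCompact K) (c : ℕ → Coins d L)
    (q : ℕ) : iterate K Φ η f c q ∈ interior K :=
  hΦ.rftlPoint_mem hK _ _

lemma action_eq (c : ℕ → Coins d L) (q : ℕ) (j : Fin L) :
    action K Φ η f c (q * L + j)
      = if j = (c q).1 then exploreAction Φ (iterate K Φ η f c q) (c q)
        else iterate K Φ η f c q := by
  have hL : 0 < L := j.pos
  have h1 : (q * L + j) % L = j := by
    rw [Nat.mul_add_mod', Nat.mod_eq_of_lt j.2]
  have h2 : (q * L + j) / L = q := by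
    rw [Nat.add_div_of_dvd_right (Dvd.intro_left q rfl), Nat.mul_div_cancel _ hL,
      Nat.div_eq_of_lt j.2, add_zero]
  rw [action, h1, h2]
  simp only [Fin.ext_iff]

lemma action_mem_box (hΦ : IsSelfConcordantBarrier K ν Φ) (hK : IsCompact K)
    (hKD : K ⊆ Metric.closedBall 0 D) (hKa : K ⊆ box a) {c : ℕ → Coins d L}
    (hc : ∀ q, TypicalCoins (c q)) (t : ℕ) : action K Φ η f c t ∈ box a := by
  rw [action]
  split_ifs
  · exact exploreAction_mem_box hΦ hK hKD hKa (iterate_mem hΦ hK c _) (hc _)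
  · exact hKa (interior_subset (iterate_mem hΦ hK c _))

lemma norm_action_le (hΦ : IsSelfConcordantBarrier K ν Φ) (hK : IsCompact K)
    (hKD : K ⊆ Metric.closedBall 0 D) (hKa : K ⊆ box a) {c : ℕ → Coins d L}
    (hc : ∀ q, TypicalCoins (c q)) (t : ℕ) : ‖action K Φ η f c t‖ ≤ 2 * D := by
  rw [action]
  split_ifs
  · obtain ⟨y, -, hy, h⟩ := exists_exploreAction_eq_smul hΦ hK hKD hKa
      (iterate_mem (η := η) (f := f) hΦ hK c (t / L)) (hc (t / L))
    rw [h, norm_smul, Real.norm_eq_abs, abs_of_nonneg (hc _).1.1]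
    exact (mul_le_of_le_one_left (norm_nonneg _) (hc _).1.2).trans hy
  · have h1 : ‖iterate K Φ η f c (t / L)‖ ≤ D := by
      simpa using hKD (interior_subset (iterate_mem hΦ hK c _))
    linarith [norm_nonneg (iterate K Φ η f c (t / L))]

lemma abs_inner_blockEstimate_le (hΦ : IsSelfConcordantBarrier K ν Φ) (hK : IsCompact K)
    (hKD : K ⊆ Metric.closedBall 0 D) (hKa : K ⊆ box a) (h0 : (0 : Vec d) ∈ K) (hL₁ : 0 ≤ L₁)
    (hf : ∀ t < T, IsMDSReward (box a) L₁ (f t)) {c : ℕ → Coins d L}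
    (hc : ∀ q, TypicalCoins (c q)) {q : ℕ} (hq : (q + 1) * L ≤ T) (w : Vec d) :
    |⟪blockEstimate K Φ η f c q, w⟫|
      ≤ 4 * d ^ 2 * (L₁ * D) * localNorm Φ (iterate K Φ η f c q) w :=
  abs_inner_gradEstimate_le hΦ hK hKD hKa h0 hL₁ (iterate_mem hΦ hK c q) (hc q)
    (hf _ (round_lt hq _)) w

/-- Over the full blocks the accumulated gradient estimates stay in a fixed ball. -/
lemma exists_norm_gradSum_le (hΦ : IsSelfConcordantBarrier K ν Φ) (hK : IsCompact K)
    (hKD : K ⊆ Metric.closedBall 0 D) (hKa : K ⊆ box a) (h0 : (0 : Vec d) ∈ K) (hL₁ : 0 ≤ L₁)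
    (hf : ∀ t < T, IsMDSReward (box a) L₁ (f t)) (q : ℕ) (hq : q * L ≤ T) :
    ∃ R : ℝ, ∀ c : ℕ → Coins d L, (∀ q, TypicalCoins (c q)) → ‖gradSum K Φ η f c q‖ ≤ R := by
  induction q with
  | zero => exact ⟨0, fun c _ => by simp [gradSum]⟩
  | succ q ih =>
    obtain ⟨R, hR⟩ := ih ((Nat.mul_le_mul_right L q.le_succ).trans hq)
    obtain ⟨M, hM, hloc⟩ := hΦ.exists_localNorm_rftlPoint_le hK η R
    refine ⟨R + 4 * d ^ 2 * (L₁ * D) * M, fun c hc => ?_⟩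
    have hD : 0 ≤ D := by simpa using hKD h0
    have h1 : ‖blockEstimate K Φ η f c q‖ ≤ 4 * d ^ 2 * (L₁ * D) * M := by
      set g := blockEstimate K Φ η f c q with hg
      have h2 := (le_abs_self _).trans
        (abs_inner_blockEstimate_le (η := η) hΦ hK hKD hKa h0 hL₁ hf hc hq g)
      have h3 : localNorm Φ (iterate K Φ η f c q) g ≤ M * ‖g‖ := hloc _ (hR c hc) g
      rw [← hg, real_inner_self_eq_norm_sq] at h2
      have h4 : 0 ≤ 4 * d ^ 2 * (L₁ * D) := by positivity
      rcases (norm_nonneg g).eq_or_lt with h5 | h5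
      · rw [← h5]; positivity
      · have h6 := h2.trans (mul_le_mul_of_nonneg_left h3 h4)
        refine le_of_mul_le_mul_right ?_ h5
        linarith
    exact (norm_add_le _ _).trans (add_le_add (hR c hc) h1)

/-- The accumulated gradient estimates of the first `q` blocks are measurable for any
`σ`-algebra that makes the coins of these blocks measurable. -/
lemma measurable_gradSum {Ω : Type*} [MeasurableSpace Ω] {c : ℕ → Ω → Coins d L}
    (hΦ : IsSelfConcordantBarrier K ν Φ) (hK : IsCompact K)
    (hf : ∀ t < T, IsMDSReward (box a) L₁ (f t)) (q : ℕ) (hq : q * L ≤ T)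
    (hc : ∀ i < q, Measurable (c i)) :
    Measurable fun ω => gradSum K Φ η f (fun q => c q ω) q := by
  induction q with
  | zero => exact measurable_const
  | succ q ih =>
    have h1 := ih ((Nat.mul_le_mul_right L q.le_succ).trans hq)
      fun i hi => hc i (hi.trans q.lt_succ_self)
    exact h1.add (measurable_gradEstimate hΦ hK ((measurable_rftlPoint hΦ hK η).comp h1)
      (fun ω => hΦ.rftlPoint_mem hK η _) (hc q q.lt_succ_self)
      (F := fun j => f (q * L + j)) fun j => (hf _ (round_lt hq j)).continuous.measurable)

variable {Ω : Type*} [MeasurableSpace Ω] {P : Measure Ω} {c : ℕ → Ω → Coins d L}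

lemma measurable_iterate (hΦ : IsSelfConcordantBarrier K ν Φ) (hK : IsCompact K)
    (hf : ∀ t < T, IsMDSReward (box a) L₁ (f t)) (q : ℕ) (hq : q * L ≤ T)
    (hc : ∀ q, Measurable (c q)) : Measurable fun ω => iterate K Φ η f (fun q => c q ω) q :=
  (measurable_rftlPoint hΦ hK η).comp (measurable_gradSum hΦ hK hf q hq fun i _ => hc i)

lemma measurable_action (hΦ : IsSelfConcordantBarrier K ν Φ) (hK : IsCompact K)
    (hf : ∀ t < T, IsMDSReward (box a) L₁ (f t)) {t : ℕ} (ht : t < T)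
    (hc : ∀ q, Measurable (c q)) : Measurable fun ω => action K Φ η f (fun q => c q ω) t := by
  have hX := measurable_iterate (η := η) hΦ hK hf (t / L) ((Nat.div_mul_le_self t L).trans ht.le) hc
  refine Measurable.ite ?_ (measurable_exploreAction hΦ hK hX (fun ω => iterate_mem hΦ hK _ _)
    (hc _)) hX
  exact (hc (t / L)).fst (MeasurableSet.of_discrete (s := {j : Fin L | t % L = j}))

lemma ae_forall_typicalCoins [NeZero L] (hd : 1 ≤ d) (hc : ∀ q, Measurable (c q))
    (hlaw : ∀ q, P.map (c q) = coinLaw d L) : ∀ᵐ ω ∂P, ∀ q, TypicalCoins (c q ω) := by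
  refine ae_all_iff.2 fun q => ?_
  have := ae_typicalCoins (d := d) (L := L) hd
  rw [← hlaw q] at this
  exact ae_of_ae_map (hc q).aemeasurable this

/-- The point used in a block is independent of the coins of that block. -/
lemma indepFun_gradSum (hΦ : IsSelfConcordantBarrier K ν Φ) (hK : IsCompact K)
    (hf : ∀ t < T, IsMDSReward (box a) L₁ (f t)) (q : ℕ) (hq : q * L ≤ T)
    (hc : ∀ q, Measurable (c q)) (hind : iIndepFun c P) :
    IndepFun (fun ω => gradSum K Φ η f (fun q => c q ω) q) (c q) P := by
  have h1 := indep_iSup_of_disjoint (fun i => (hc i).comap_le) hind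
    (S := Set.Iio q) (T := {q}) (by simp)
  rw [IndepFun_iff_Indep]
  refine indep_of_indep_of_le_left (indep_of_indep_of_le_right h1 ?_) ?_
  · exact le_iSup₂_of_le q rfl le_rfl
  · refine Measurable.comap_le ?_
    refine @measurable_gradSum d L K ν η L₁ Φ a f T Ω
      (⨆ i ∈ Set.Iio q, MeasurableSpace.comap (c i) inferInstance) c hΦ hK hf q hq fun i hi => ?_
    exact measurable_iff_comap_le.2 (le_iSup₂_of_le i hi le_rfl)

lemma integrable_inner_blockEstimate [NeZero L] [IsProbabilityMeasure P] (hd : 1 ≤ d)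
    (hΦ : IsSelfConcordantBarrier K ν Φ) (hK : IsCompact K)
    (hKD : K ⊆ Metric.closedBall 0 D) (hKa : K ⊆ box a) (h0 : (0 : Vec d) ∈ K) (hL₁ : 0 ≤ L₁)
    (hf : ∀ t < T, IsMDSReward (box a) L₁ (f t)) (hc : ∀ q, Measurable (c q))
    (hlaw : ∀ q, P.map (c q) = coinLaw d L) {q : ℕ} (hq : (q + 1) * L ≤ T)
    {y : Vec d} (hy : y ∈ K) :
    Integrable (fun ω => ⟪blockEstimate K Φ η f (fun q => c q ω) q,
      y - iterate K Φ η f (fun q => c q ω) q⟫) P := by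
  have hq' : q * L ≤ T := (Nat.mul_le_mul_right L q.le_succ).trans hq
  obtain ⟨R, hR⟩ := exists_norm_gradSum_le (η := η) hΦ hK hKD hKa h0 hL₁ hf q hq'
  obtain ⟨M, hM, hloc⟩ := hΦ.exists_localNorm_rftlPoint_le hK η R
  have hD : 0 ≤ D := by simpa using hKD h0
  have hX := measurable_iterate (η := η) hΦ hK hf q hq' hc
  have hm := measurable_gradEstimate hΦ hK hX (fun ω => iterate_mem hΦ hK _ _) (hc q)
    (F := fun j => f (q * L + j)) fun j => (hf _ (round_lt hq j)).continuous.measurable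
  refine Integrable.of_bound (hm.inner (measurable_const.sub hX)).aestronglyMeasurable
    (4 * d ^ 2 * (L₁ * D) * (M * (2 * D))) ?_
  filter_upwards [ae_forall_typicalCoins hd hc hlaw] with ω hω
  refine (abs_inner_blockEstimate_le hΦ hK hKD hKa h0 hL₁ hf hω hq _).trans ?_
  have h1 : ‖y - iterate K Φ η f (fun q => c q ω) q‖ ≤ 2 * D := by
    have h2 : ‖y‖ ≤ D := by simpa using hKD hy
    have h3 : ‖iterate K Φ η f (fun q => c q ω) q‖ ≤ D := by
      simpa using hKD (interior_subset (iterate_mem hΦ hK (fun q => c q ω) q))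
    linarith [norm_sub_le y (iterate K Φ η f (fun q => c q ω) q)]
  have h4 : localNorm Φ (iterate K Φ η f (fun q => c q ω) q)
      (y - iterate K Φ η f (fun q => c q ω) q) ≤ M * (2 * D) :=
    (hloc _ (hR _ hω) _).trans (mul_le_mul_of_nonneg_left h1 hM)
  exact mul_le_mul_of_nonneg_left h4 (by positivity)

lemma integrable_reward_iterate [IsProbabilityMeasure P]
    (hΦ : IsSelfConcordantBarrier K ν Φ) (hK : IsCompact K)
    (hKD : K ⊆ Metric.closedBall 0 D) (hKa : K ⊆ box a) (h0 : (0 : Vec d) ∈ K) (hL₁ : 0 ≤ L₁)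
    (hf : ∀ t < T, IsMDSReward (box a) L₁ (f t)) (hc : ∀ q, Measurable (c q))
    {q : ℕ} (hq : q * L ≤ T) {t : ℕ} (ht : t < T) :
    Integrable (fun ω => f t (iterate K Φ η f (fun q => c q ω) q)) P := by
  have hX := measurable_iterate (η := η) hΦ hK hf q hq hc
  refine Integrable.of_bound ((hf t ht).continuous.measurable.comp hX).aestronglyMeasurable
    (L₁ * D) (ae_of_all _ fun ω => ?_)
  have hmem := interior_subset (iterate_mem (η := η) (f := f) hΦ hK (fun q => c q ω) q)
  have h1 : ‖iterate K Φ η f (fun q => c q ω) q‖ ≤ D := by simpa using hKD hmem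
  rw [Real.norm_eq_abs, abs_of_nonneg ((hf t ht).nonneg (hKa hmem))]
  exact ((hf t ht).le_mul_norm (hKa h0) (hKa hmem)).trans (mul_le_mul_of_nonneg_left h1 hL₁)

lemma integrable_reward_action [NeZero L] [IsProbabilityMeasure P] (hd : 1 ≤ d)
    (hΦ : IsSelfConcordantBarrier K ν Φ) (hK : IsCompact K)
    (hKD : K ⊆ Metric.closedBall 0 D) (hKa : K ⊆ box a) (h0 : (0 : Vec d) ∈ K) (hL₁ : 0 ≤ L₁)
    (hf : ∀ t < T, IsMDSReward (box a) L₁ (f t)) (hc : ∀ q, Measurable (c q))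
    (hlaw : ∀ q, P.map (c q) = coinLaw d L) {t : ℕ} (ht : t < T) :
    Integrable (fun ω => f t (action K Φ η f (fun q => c q ω) t)) P := by
  refine Integrable.of_bound ((hf t ht).continuous.measurable.comp
    (measurable_action hΦ hK hf ht hc)).aestronglyMeasurable (L₁ * (2 * D)) ?_
  filter_upwards [ae_forall_typicalCoins hd hc hlaw] with ω hω
  have hmem := action_mem_box (η := η) (f := f) hΦ hK hKD hKa hω t
  rw [Real.norm_eq_abs, abs_of_nonneg ((hf t ht).nonneg hmem)]
  exact ((hf t ht).le_mul_norm (hKa h0) hmem).trans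
    (mul_le_mul_of_nonneg_left (norm_action_le hΦ hK hKD hKa hω t) hL₁)

/-- The expected regret of the iterates during a full block is controlled by the linear regret of
the gradient estimates: condition on the coins of the earlier blocks. -/
lemma integral_block_le [NeZero L] [IsProbabilityMeasure P] (hd : 1 ≤ d)
    (hΦ : IsSelfConcordantBarrier K ν Φ) (hK : IsCompact K)
    (hKD : K ⊆ Metric.closedBall 0 D) (hKa : K ⊆ box a) (h0 : (0 : Vec d) ∈ K) (hL₁ : 0 ≤ L₁)
    (hf : ∀ t < T, IsMDSReward (box a) L₁ (f t)) (hc : ∀ q, Measurable (c q))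
    (hlaw : ∀ q, P.map (c q) = coinLaw d L) (hind : iIndepFun c P) {q : ℕ}
    (hq : (q + 1) * L ≤ T) {y : Vec d} (hy : y ∈ K) :
    ∫ ω, ∑ j : Fin L, ((1 - 1 / Real.exp 1) * f (q * L + j) y
        - f (q * L + j) (iterate K Φ η f (fun q => c q ω) q)) ∂P
      ≤ L * ∫ ω, ⟪blockEstimate K Φ η f (fun q => c q ω) q,
          y - iterate K Φ η f (fun q => c q ω) q⟫ ∂P := by
  have hq' : q * L ≤ T := (Nat.mul_le_mul_right L q.le_succ).trans hq
  have hF : ∀ j : Fin L, IsMDSReward (box a) L₁ (f (q * L + j)) := fun j => hf _ (round_lt hq j)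
  have := isProbabilityMeasure_coinLaw (d := d) (L := L) hd
  set S : Ω → Vec d := fun ω => gradSum K Φ η f (fun q => c q ω) q with hS
  have hSm : Measurable S := measurable_gradSum hΦ hK hf q hq' fun i _ => hc i
  set h : Vec d × Coins d L → ℝ := fun p => ⟪gradEstimate Φ (rftlPoint K Φ η p.1) p.2
    (f (q * L + p.2.1) (exploreAction Φ (rftlPoint K Φ η p.1) p.2)), y - rftlPoint K Φ η p.1⟫
    with hh
  have hXm : Measurable fun p : Vec d × Coins d L => rftlPoint K Φ η p.1 :=
    (measurable_rftlPoint hΦ hK η).comp measurable_fst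
  have hhm : Measurable h :=
    (measurable_gradEstimate hΦ hK hXm (fun p => hΦ.rftlPoint_mem hK η _) measurable_snd
      (F := fun j => f (q * L + j)) fun j => (hF j).continuous.measurable).inner
      (measurable_const.sub hXm)
  have hmap : P.map (fun ω => (S ω, c q ω)) = (P.map S).prod (coinLaw d L) := by
    rw [← hlaw q]
    exact (indepFun_iff_map_prod_eq_prod_map_map hSm.aemeasurable (hc q).aemeasurable).1
      (indepFun_gradSum hΦ hK hf q hq' hc hind)
  have hpm : Measurable fun ω => (S ω, c q ω) := hSm.prodMk (hc q)
  have hPS : IsProbabilityMeasure (P.map S) := Measure.isProbabilityMeasure_map hSm.aemeasurable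
  have hint : Integrable h ((P.map S).prod (coinLaw d L)) := by
    rw [← hmap, integrable_map_measure hhm.aestronglyMeasurable hpm.aemeasurable]
    exact integrable_inner_blockEstimate hd hΦ hK hKD hKa h0 hL₁ hf hc hlaw hq hy
  have e1 : ∫ ω, ⟪blockEstimate K Φ η f (fun q => c q ω) q,
      y - iterate K Φ η f (fun q => c q ω) q⟫ ∂P = ∫ s, ∫ c, h (s, c) ∂coinLaw d L ∂P.map S := by
    rw [← integral_prod _ hint, ← hmap, integral_map hpm.aemeasurable hhm.aestronglyMeasurable]
    rfl
  rw [e1, integral_map hSm.aemeasurable hint.integral_prod_left.aestronglyMeasurable,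
    ← integral_const_mul]
  refine integral_mono ?_ ?_ fun ω => ?_
  · exact integrable_finsetSum _ fun j _ => (integrable_const _).sub
      (integrable_reward_iterate hΦ hK hKD hKa h0 hL₁ hf hc hq' (round_lt hq j))
  · exact ((integrable_map_measure hint.integral_prod_left.aestronglyMeasurable
      hSm.aemeasurable).1 hint.integral_prod_left).const_mul _
  · exact sum_sub_le_integral_inner_gradEstimate hd hΦ hK hKD hKa h0 hL₁
      (iterate_mem hΦ hK _ q) hy hF

/-- Exploration costs at most the range of one reward per block. -/
lemma sum_reward_iterate_le (hΦ : IsSelfConcordantBarrier K ν Φ) (hK : IsCompact K)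
    (hKD : K ⊆ Metric.closedBall 0 D) (hKa : K ⊆ box a) (h0 : (0 : Vec d) ∈ K) (hL₁ : 0 ≤ L₁)
    (hf : ∀ t < T, IsMDSReward (box a) L₁ (f t)) {c : ℕ → Coins d L}
    (hc : ∀ q, TypicalCoins (c q)) {q : ℕ} (hq : (q + 1) * L ≤ T) :
    ∑ j : Fin L, f (q * L + j) (iterate K Φ η f c q)
      ≤ ∑ j : Fin L, f (q * L + j) (action K Φ η f c (q * L + j)) + L₁ * D := by
  have hmem := interior_subset (iterate_mem (η := η) (f := f) hΦ hK c q)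
  have hn : ‖iterate K Φ η f c q‖ ≤ D := by simpa using hKD hmem
  have hsum : ∑ j : Fin L, (if j = (c q).1 then L₁ * D else 0) = L₁ * D := by simp
  rw [← hsum, ← Finset.sum_add_distrib]
  refine Finset.sum_le_sum fun j _ => ?_
  have hfj := hf _ (round_lt hq j)
  have hbox := hfj.nonneg (action_mem_box (η := η) (f := f) hΦ hK hKD hKa hc (q * L + j))
  by_cases hj : j = (c q).1
  · rw [if_pos hj]
    have := (hfj.le_mul_norm (hKa h0) (hKa hmem)).trans (mul_le_mul_of_nonneg_left hn hL₁)
    linarith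
  · rw [action_eq, if_neg hj, if_neg hj, add_zero]

lemma sum_range_mul (g : ℕ → ℝ) (N L : ℕ) :
    ∑ t ∈ Finset.range (N * L), g t = ∑ q ∈ Finset.range N, ∑ j : Fin L, g (q * L + j) := by
  induction N with
  | zero => simp
  | succ N ih =>
    rw [add_mul, one_mul, Finset.sum_range_add, ih, Finset.sum_range_succ,
      ← Fin.sum_univ_eq_sum_range (fun j => g (N * L + j))]

end BanditMLSM

/-! ### The regret -/

namespace BanditMLSM

variable {d L : ℕ} {K : Set (Vec d)} {ν η D L₁ : ℝ} {Φ : Vec d → ℝ} {a : Fin d → ℝ}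
  {f : ℕ → Vec d → ℝ} {T : ℕ}

lemma mul_reward_le (hKD : K ⊆ Metric.closedBall 0 D) (hKa : K ⊆ box a) (h0 : (0 : Vec d) ∈ K)
    (hL₁ : 0 ≤ L₁) {g : Vec d → ℝ} (hg : IsMDSReward (box a) L₁ g) {x : Vec d} (hx : x ∈ K) :
    (1 - 1 / Real.exp 1) * g x ≤ L₁ * D := by
  have hn : ‖x‖ ≤ D := by simpa using hKD hx
  exact (mul_le_of_le_one_left (hg.nonneg (hKa hx)) one_sub_exp_mem.2).trans
    ((hg.le_mul_norm (hKa h0) (hKa hx)).trans (mul_le_mul_of_nonneg_left hn hL₁))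

lemma sum_regret_le_trivial (hΦ : IsSelfConcordantBarrier K ν Φ) (hK : IsCompact K)
    (hKD : K ⊆ Metric.closedBall 0 D) (hKa : K ⊆ box a) (h0 : (0 : Vec d) ∈ K) (hL₁ : 0 ≤ L₁)
    (hf : ∀ t < T, IsMDSReward (box a) L₁ (f t)) {c : ℕ → Coins d L}
    (hc : ∀ q, TypicalCoins (c q)) {x : Vec d} (hx : x ∈ K) :
    ∑ t ∈ Finset.range T, ((1 - 1 / Real.exp 1) * f t x - f t (action K Φ η f c t))
      ≤ T * (L₁ * D) := by
  have := Finset.sum_le_card_nsmul (Finset.range T)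
    (fun t => (1 - 1 / Real.exp 1) * f t x - f t (action K Φ η f c t)) (L₁ * D) fun t ht => by
      have hft := hf t (Finset.mem_range.1 ht)
      have h1 := mul_reward_le hKD hKa h0 hL₁ hft hx
      have h2 := hft.nonneg (action_mem_box (η := η) (f := f) hΦ hK hKD hKa hc t)
      linarith
  simpa using this

/-- The regret against `x` compared with that of the iterates against a nearby point `y`: the
three parts of the extra cost come from the distance of `x` and `y`, from the rounds after the last
full block, and from the exploration rounds. -/
lemma sum_regret_le (hL : 0 < L) (hT : 0 < T) (hΦ : IsSelfConcordantBarrier K ν Φ)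
    (hK : IsCompact K) (hKD : K ⊆ Metric.closedBall 0 D) (hKa : K ⊆ box a)
    (h0 : (0 : Vec d) ∈ K) (hL₁ : 0 ≤ L₁) (hf : ∀ t < T, IsMDSReward (box a) L₁ (f t))
    {c : ℕ → Coins d L} (hc : ∀ q, TypicalCoins (c q)) {x y : Vec d} (hx : x ∈ K) (hy : y ∈ K)
    (hxy : ‖x - y‖ ≤ 2 * D / T) :
    ∑ t ∈ Finset.range T, ((1 - 1 / Real.exp 1) * f t x - f t (action K Φ η f c t))
      ≤ ∑ q ∈ Finset.range (T / L), ∑ j : Fin L, ((1 - 1 / Real.exp 1) * f (q * L + j) y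
          - f (q * L + j) (iterate K Φ η f c q)) + (2 + L + (T / L : ℕ)) * (L₁ * D) := by
  have hD : 0 ≤ D := by simpa using hKD h0
  have hT' : (0 : ℝ) < T := by exact_mod_cast hT
  have hα := one_sub_exp_mem
  set N := T / L with hN
  have hNL : N * L ≤ T := Nat.div_mul_le_self T L
  -- The Lipschitz bound, summed over all `T` rounds, pays for the move from `x` to `y`.
  have h1 : ∑ t ∈ Finset.range T, ((1 - 1 / Real.exp 1) * f t x - f t (action K Φ η f c t))
      ≤ ∑ t ∈ Finset.range T, ((1 - 1 / Real.exp 1) * f t y - f t (action K Φ η f c t))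
        + 2 * (L₁ * D) := by
    have e : 2 * (L₁ * D) = ∑ t ∈ Finset.range T, L₁ * (2 * D / T) := by
      rw [Finset.sum_const, Finset.card_range, nsmul_eq_mul]
      field_simp
    rw [e, ← Finset.sum_add_distrib]
    refine Finset.sum_le_sum fun t ht => ?_
    have hft := hf t (Finset.mem_range.1 ht)
    have h2 := (le_abs_self _).trans (hft.lipschitz x (hKa hx) y (hKa hy))
    have h3 := h2.trans (mul_le_mul_of_nonneg_left hxy hL₁)
    have h4 : (1 - 1 / Real.exp 1) * (f t x - f t y) ≤ L₁ * (2 * D / T) :=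
      (mul_le_mul_of_nonneg_left h3 hα.1).trans
        (mul_le_of_le_one_left (by positivity) hα.2)
    linarith
  -- Fewer than `L` rounds follow the last full block; each of them costs at most `L₁ D`.
  have h5 : ∑ t ∈ Finset.range T, ((1 - 1 / Real.exp 1) * f t y - f t (action K Φ η f c t))
      ≤ ∑ t ∈ Finset.range (N * L), ((1 - 1 / Real.exp 1) * f t y - f t (action K Φ η f c t))
        + L * (L₁ * D) := by
    obtain ⟨r, hr⟩ := Nat.exists_eq_add_of_le hNL
    have hrL : r ≤ L := by
      have h6 := Nat.lt_div_mul_add hL (a := T)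
      rw [← hN] at h6
      omega
    conv_lhs => rw [hr, Finset.sum_range_add]
    have h7 := Finset.sum_le_card_nsmul (Finset.range r)
      (fun i => (1 - 1 / Real.exp 1) * f (N * L + i) y
        - f (N * L + i) (action K Φ η f c (N * L + i))) (L₁ * D) fun i hi => by
        have hft := hf (N * L + i) (by rw [hr]; have := Finset.mem_range.1 hi; omega)
        have h8 := mul_reward_le hKD hKa h0 hL₁ hft hy
        have h9 := hft.nonneg (action_mem_box (η := η) (f := f) hΦ hK hKD hKa hc (N * L + i))
        linarith
    rw [Finset.card_range, nsmul_eq_mul] at h7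
    have h10 : (r : ℝ) * (L₁ * D) ≤ L * (L₁ * D) :=
      mul_le_mul_of_nonneg_right (by exact_mod_cast hrL) (by positivity)
    linarith
  -- In a full block the iterate is played except in one round.
  have h11 : ∑ t ∈ Finset.range (N * L),
        ((1 - 1 / Real.exp 1) * f t y - f t (action K Φ η f c t))
      ≤ ∑ q ∈ Finset.range N, ∑ j : Fin L, ((1 - 1 / Real.exp 1) * f (q * L + j) y
          - f (q * L + j) (iterate K Φ η f c q)) + N * (L₁ * D) := by
    have e : (N : ℝ) * (L₁ * D) = ∑ q ∈ Finset.range N, L₁ * D := by simp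
    rw [sum_range_mul, e, ← Finset.sum_add_distrib]
    refine Finset.sum_le_sum fun q hq => ?_
    have hq' : (q + 1) * L ≤ T :=
      (Nat.mul_le_mul_right L (Finset.mem_range.1 hq)).trans hNL
    have := sum_reward_iterate_le (η := η) hΦ hK hKD hKa h0 hL₁ hf hc hq'
    simp only [Finset.sum_sub_distrib]
    linarith
  linarith

variable {Ω : Type*} [MeasurableSpace Ω] {P : Measure Ω} {c : ℕ → Ω → Coins d L}

lemma regretAgainst_eq [NeZero L] [IsProbabilityMeasure P] (hd : 1 ≤ d)
    (hΦ : IsSelfConcordantBarrier K ν Φ) (hK : IsCompact K)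
    (hKD : K ⊆ Metric.closedBall 0 D) (hKa : K ⊆ box a) (h0 : (0 : Vec d) ∈ K) (hL₁ : 0 ≤ L₁)
    (hf : ∀ t < T, IsMDSReward (box a) L₁ (f t)) (hc : ∀ q, Measurable (c q))
    (hlaw : ∀ q, P.map (c q) = coinLaw d L) (α : ℝ) (x : Vec d) :
    regretAgainst P α T f (fun t ω => action K Φ η f (fun q => c q ω) t) x
      = ∑ t ∈ Finset.range T,
        (α * f t x - ∫ ω, f t (action K Φ η f (fun q => c q ω) t) ∂P) := by
  have hint : ∀ t ∈ Finset.range T,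
      Integrable (fun ω => f t (action K Φ η f (fun q => c q ω) t)) P := fun t ht =>
    integrable_reward_action hd hΦ hK hKD hKa h0 hL₁ hf hc hlaw (Finset.mem_range.1 ht)
  have hint' : ∀ t ∈ Finset.range T,
      Integrable (fun ω => α * f t x - f t (action K Φ η f (fun q => c q ω) t)) P := fun t ht =>
    (integrable_const _).sub (hint t ht)
  rw [regretAgainst, integral_finsetSum _ hint']
  refine Finset.sum_congr rfl fun t ht => ?_
  rw [integral_sub (integrable_const _) (hint t ht)]
  simp

lemma integrable_sum_regret [NeZero L] [IsProbabilityMeasure P] (hd : 1 ≤ d)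
    (hΦ : IsSelfConcordantBarrier K ν Φ) (hK : IsCompact K)
    (hKD : K ⊆ Metric.closedBall 0 D) (hKa : K ⊆ box a) (h0 : (0 : Vec d) ∈ K) (hL₁ : 0 ≤ L₁)
    (hf : ∀ t < T, IsMDSReward (box a) L₁ (f t)) (hc : ∀ q, Measurable (c q))
    (hlaw : ∀ q, P.map (c q) = coinLaw d L) (α : ℝ) (x : Vec d) :
    Integrable (fun ω => ∑ t ∈ Finset.range T,
      (α * f t x - f t (action K Φ η f (fun q => c q ω) t))) P :=
  integrable_finsetSum _ fun _ ht => (integrable_const _).sub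
    (integrable_reward_action hd hΦ hK hKD hKa h0 hL₁ hf hc hlaw (Finset.mem_range.1 ht))

lemma regretAgainst_le_trivial [NeZero L] [IsProbabilityMeasure P] (hd : 1 ≤ d)
    (hΦ : IsSelfConcordantBarrier K ν Φ) (hK : IsCompact K)
    (hKD : K ⊆ Metric.closedBall 0 D) (hKa : K ⊆ box a) (h0 : (0 : Vec d) ∈ K) (hL₁ : 0 ≤ L₁)
    (hf : ∀ t < T, IsMDSReward (box a) L₁ (f t)) (hc : ∀ q, Measurable (c q))
    (hlaw : ∀ q, P.map (c q) = coinLaw d L) {x : Vec d} (hx : x ∈ K) :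
    regretAgainst P (1 - 1 / Real.exp 1) T f (fun t ω => action K Φ η f (fun q => c q ω) t) x
      ≤ T * (L₁ * D) := by
  have h := integral_mono_ae
    (integrable_sum_regret (η := η) hd hΦ hK hKD hKa h0 hL₁ hf hc hlaw (1 - 1 / Real.exp 1) x)
    (integrable_const (μ := P) ((T : ℝ) * (L₁ * D))) (by
      filter_upwards [ae_forall_typicalCoins hd hc hlaw] with ω hω
      exact sum_regret_le_trivial hΦ hK hKD hKa h0 hL₁ hf hω hx)
  simpa [regretAgainst] using h

/-- The regret bound before the parameters are chosen. -/
lemma regretAgainst_le [NeZero L] [IsProbabilityMeasure P] (hd : 1 ≤ d) (hT : 0 < T) (hη : 0 < η)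
    (hΦ : IsSelfConcordantBarrier K ν Φ) (hK : IsCompact K)
    (hKD : K ⊆ Metric.closedBall 0 D) (hKa : K ⊆ box a) (h0 : (0 : Vec d) ∈ K) (hL₁ : 0 ≤ L₁)
    (hf : ∀ t < T, IsMDSReward (box a) L₁ (f t)) (hc : ∀ q, Measurable (c q))
    (hlaw : ∀ q, P.map (c q) = coinLaw d L) (hind : iIndepFun c P)
    (hηb : η * (4 * d ^ 2 * (L₁ * D)) ≤ 1 / 2) {x : Vec d} (hx : x ∈ K) :
    regretAgainst P (1 - 1 / Real.exp 1) T f (fun t ω => action K Φ η f (fun q => c q ω) t) x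
      ≤ L * ((T / L : ℕ) * (2 * η * (4 * d ^ 2 * (L₁ * D)) ^ 2) + ν * Real.log T / η)
        + (2 + L + (T / L : ℕ)) * (L₁ * D) := by
  have hD : 0 ≤ D := by simpa using hKD h0
  have hT' : (0 : ℝ) < T := by exact_mod_cast hT
  have hL : 0 < L := Nat.pos_of_neZero L
  set N := T / L with hN
  have hNL : N * L ≤ T := Nat.div_mul_le_self T L
  have hblock : ∀ q ∈ Finset.range N, (q + 1) * L ≤ T := fun q hq =>
    (Nat.mul_le_mul_right L (Finset.mem_range.1 hq)).trans hNL
  set x₀ := rftlPoint K Φ η 0 with hx₀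
  have hx₀mem : x₀ ∈ interior K := hΦ.rftlPoint_mem hK η 0
  -- The comparator is moved into the interior, at a distance of order `1 / T`.
  have hs : (1 - 1 / (T : ℝ)) ∈ Set.Ico (0 : ℝ) 1 := by
    refine ⟨?_, by linarith [one_div_pos.2 hT']⟩
    rw [sub_nonneg, div_le_one hT']
    exact_mod_cast hT
  set y := x₀ + (1 - 1 / (T : ℝ)) • (x - x₀) with hy
  have hyi : y ∈ interior K := hΦ.add_smul_sub_mem_interior hx₀mem hx hs
  have hyK := interior_subset hyi
  have hlog : Φ y - Φ x₀ ≤ ν * Real.log T := by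
    have := hΦ.sub_le_log hx₀mem hx hs
    rw [sub_sub_cancel, Real.log_div one_ne_zero hT'.ne', Real.log_one, zero_sub, mul_neg,
      neg_neg] at this
    exact this
  have hxy : ‖x - y‖ ≤ 2 * D / T := by
    have e : x - y = (1 / (T : ℝ)) • (x - x₀) := by rw [hy]; module
    rw [e, norm_smul, Real.norm_eq_abs, abs_of_pos (one_div_pos.2 hT'), one_div_mul_eq_div]
    have h1 : ‖x‖ ≤ D := by simpa using hKD hx
    have h2 : ‖x₀‖ ≤ D := by simpa using hKD (interior_subset hx₀mem)
    gcongr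
    linarith [norm_sub_le x x₀]
  have hq' : ∀ q ∈ Finset.range N, q * L ≤ T := fun q hq =>
    (Nat.mul_le_mul_right L q.le_succ).trans (hblock q hq)
  have hint1 : ∀ q ∈ Finset.range N, Integrable (fun ω => ∑ j : Fin L,
      ((1 - 1 / Real.exp 1) * f (q * L + j) y
        - f (q * L + j) (iterate K Φ η f (fun q => c q ω) q))) P := fun q hq =>
    integrable_finsetSum _ fun j _ => (integrable_const _).sub
      (integrable_reward_iterate hΦ hK hKD hKa h0 hL₁ hf hc (hq' q hq) (round_lt (hblock q hq) j))
  have hint2 : ∀ q ∈ Finset.range N, Integrable (fun ω =>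
      ⟪blockEstimate K Φ η f (fun q => c q ω) q, y - iterate K Φ η f (fun q => c q ω) q⟫) P :=
    fun q hq =>
      integrable_inner_blockEstimate hd hΦ hK hKD hKa h0 hL₁ hf hc hlaw (hblock q hq) hyK
  have h1 : regretAgainst P (1 - 1 / Real.exp 1) T f
        (fun t ω => action K Φ η f (fun q => c q ω) t) x
      ≤ ∑ q ∈ Finset.range N, ∫ ω, ∑ j : Fin L, ((1 - 1 / Real.exp 1) * f (q * L + j) y
          - f (q * L + j) (iterate K Φ η f (fun q => c q ω) q)) ∂P
        + (2 + L + N) * (L₁ * D) := by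
    have h := integral_mono_ae
      (integrable_sum_regret (η := η) hd hΦ hK hKD hKa h0 hL₁ hf hc hlaw (1 - 1 / Real.exp 1) x)
      ((integrable_finsetSum _ hint1).add
        (integrable_const (μ := P) ((2 + L + N : ℝ) * (L₁ * D)))) (by
        filter_upwards [ae_forall_typicalCoins hd hc hlaw] with ω hω
        exact sum_regret_le hL hT hΦ hK hKD hKa h0 hL₁ hf hω hx hyK hxy)
    refine h.trans (le_of_eq ?_)
    rw [integral_add' (integrable_finsetSum _ hint1) (integrable_const _),
      integral_finsetSum _ hint1]
    simp
  have h2 : ∑ q ∈ Finset.range N, ∫ ω, ∑ j : Fin L, ((1 - 1 / Real.exp 1) * f (q * L + j) y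
          - f (q * L + j) (iterate K Φ η f (fun q => c q ω) q)) ∂P
      ≤ L * ∫ ω, ∑ q ∈ Finset.range N, ⟪blockEstimate K Φ η f (fun q => c q ω) q,
          y - iterate K Φ η f (fun q => c q ω) q⟫ ∂P := by
    rw [integral_finsetSum _ hint2, Finset.mul_sum]
    exact Finset.sum_le_sum fun q hq =>
      integral_block_le hd hΦ hK hKD hKa h0 hL₁ hf hc hlaw hind (hblock q hq) hyK
  have h3 : ∫ ω, ∑ q ∈ Finset.range N, ⟪blockEstimate K Φ η f (fun q => c q ω) q,
        y - iterate K Φ η f (fun q => c q ω) q⟫ ∂P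
      ≤ N * (2 * η * (4 * d ^ 2 * (L₁ * D)) ^ 2) + ν * Real.log T / η := by
    have h := integral_mono_ae (integrable_finsetSum _ hint2) (integrable_const (μ := P)
      (N * (2 * η * (4 * d ^ 2 * (L₁ * D)) ^ 2) + ν * Real.log T / η)) (by
      filter_upwards [ae_forall_typicalCoins hd hc hlaw] with ω hω
      have h4 := hΦ.sum_inner_sub_rftlPoint_le hK hη
        (blockEstimate K Φ η f (fun q => c q ω)) N (by positivity) hηb
        (fun q hq w => by
          rw [← gradSum_eq_sum]
          exact abs_inner_blockEstimate_le hΦ hK hKD hKa h0 hL₁ hf hω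
            (hblock q (Finset.mem_range.2 hq)) w) hyi
      simp only [← gradSum_eq_sum] at h4
      refine h4.trans ?_
      gcongr)
    simpa using h
  have h5 := mul_le_mul_of_nonneg_left h3 (Nat.cast_nonneg (α := ℝ) L)
  linarith

/-- The choice of the parameters. With `δ = d^{1/3}` and `τ = T^{1/3}` the step size is
`η = 1 / (δ⁸ τ)` and the block length is `L = ⌈τ / δ⁴⌉`. -/
lemma parameter_bound {δ τ A νl l n : ℝ} (hδ : 1 ≤ δ) (hA : 0 ≤ A)
    (hνl : 1 / 12 ≤ νl) (hτδ : δ ^ 4 ≤ τ) (hl : l ≤ τ / δ ^ 4 + 1) (hn0 : 0 ≤ n)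
    (hnl : l * n ≤ τ ^ 3) (hl' : τ / δ ^ 4 ≤ l) :
    l * (n * (2 * (1 / (δ ^ 8 * τ)) * (4 * (δ ^ 3) ^ 2 * A) ^ 2) + νl / (1 / (δ ^ 8 * τ)))
      + (2 + l + n) * A ≤ 400 * (1 + A) ^ 2 * νl * (δ ^ 4 * τ ^ 2) := by
  have hδ0 : 0 < δ := by linarith
  have hδ4 : 1 ≤ δ ^ 4 := one_le_pow₀ hδ
  have hτ : 1 ≤ τ := hδ4.trans hτδ
  have hτ0 : 0 < τ := by linarith
  set p := δ ^ 4 * τ ^ 2 with hp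
  have hp1 : 1 ≤ p := one_le_mul_of_one_le_of_one_le hδ4 (one_le_pow₀ hτ)
  have h1 : 1 ≤ τ / δ ^ 4 := by rwa [one_le_div (by positivity)]
  have hl2 : l ≤ 2 * (τ / δ ^ 4) := by linarith
  have hτp : τ / δ ^ 4 ≤ p := by
    rw [div_le_iff₀ (by positivity), hp]
    have : τ * 1 ≤ τ * (τ * (δ ^ 4 * δ ^ 4)) := by
      gcongr
      exact one_le_mul_of_one_le_of_one_le hτ (one_le_mul_of_one_le_of_one_le hδ4 hδ4)
    linarith
  have hnp : n ≤ p := by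
    have h2 : τ / δ ^ 4 * n ≤ τ ^ 3 := (mul_le_mul_of_nonneg_right hl' hn0).trans hnl
    rw [div_mul_eq_mul_div, div_le_iff₀ (by positivity)] at h2
    have h3 : τ * n ≤ τ * p := by rw [hp]; linarith
    exact le_of_mul_le_mul_left h3 hτ0
  have e1 : l * (n * (2 * (1 / (δ ^ 8 * τ)) * (4 * (δ ^ 3) ^ 2 * A) ^ 2))
      = (l * n) * (32 * δ ^ 4 * A ^ 2 / τ) := by
    field_simp
    ring
  have h4 : (l * n) * (32 * δ ^ 4 * A ^ 2 / τ) ≤ 32 * A ^ 2 * p := by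
    refine (mul_le_mul_of_nonneg_right hnl (by positivity)).trans (le_of_eq ?_)
    rw [hp]
    field_simp
  have hνl0 : 0 ≤ νl := by linarith
  have h5 : l * (νl / (1 / (δ ^ 8 * τ))) ≤ 2 * νl * p := by
    refine (mul_le_mul_of_nonneg_right hl2 (by positivity)).trans (le_of_eq ?_)
    rw [hp]
    field_simp
  have h6 : (2 + l + n) * A ≤ 5 * p * A := by
    refine mul_le_mul_of_nonneg_right ?_ hA
    linarith
  have h7 : 32 * A ^ 2 * p + 5 * p * A ≤ 32 * (1 + A) ^ 2 * (12 * νl) * p := by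
    have h8 : 32 * A ^ 2 + 5 * A ≤ 32 * (1 + A) ^ 2 := by nlinarith
    have h9 : 32 * (1 + A) ^ 2 * 1 ≤ 32 * (1 + A) ^ 2 * (12 * νl) := by
      gcongr
      linarith
    rw [mul_one] at h9
    have := mul_le_mul_of_nonneg_right (h8.trans h9) (by linarith : 0 ≤ p)
    linarith
  have h10 : 2 * νl * p ≤ 2 * (1 + A) ^ 2 * νl * p := by
    have : 1 ≤ (1 + A) ^ 2 := one_le_pow₀ (by linarith)
    have h11 : 2 * (νl * p) * 1 ≤ 2 * (νl * p) * (1 + A) ^ 2 := by gcongr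
    linarith
  have h12 : 0 ≤ (1 + A) ^ 2 * νl * p := by positivity
  rw [mul_add, e1]
  linarith

/-- The trivial bound `T · L₁ D` suffices when the dimension or the range of the rewards is large
compared with `T^{1/3}`. -/
lemma trivial_bound {δ τ A νl : ℝ} (hδ : 1 ≤ δ) (hA : 0 ≤ A)
    (hνl : 1 / 12 ≤ νl) (h : τ ≤ δ ^ 4 ∨ τ ≤ 8 * A) :
    τ ^ 3 * A ≤ 400 * (1 + A) ^ 2 * νl * (δ ^ 4 * τ ^ 2) := by
  have hδ4 : 1 ≤ δ ^ 4 := one_le_pow₀ hδ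
  have hp : 0 ≤ δ ^ 4 * τ ^ 2 := by positivity
  have h1 : τ ^ 3 * A ≤ 8 * (1 + A) ^ 2 * (δ ^ 4 * τ ^ 2) := by
    rcases h with h | h
    · calc τ ^ 3 * A = τ * (τ ^ 2 * A) := by ring
        _ ≤ δ ^ 4 * (τ ^ 2 * A) := by gcongr
        _ = A * (δ ^ 4 * τ ^ 2) := by ring
        _ ≤ 8 * (1 + A) ^ 2 * (δ ^ 4 * τ ^ 2) := by gcongr; nlinarith
    · calc τ ^ 3 * A = τ * (τ ^ 2 * A) := by ring
        _ ≤ 8 * A * (τ ^ 2 * A) := by gcongr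
        _ = 8 * A ^ 2 * (1 * τ ^ 2) := by ring
        _ ≤ 8 * (1 + A) ^ 2 * (δ ^ 4 * τ ^ 2) := by gcongr; linarith
  have h2 : 8 * (1 + A) ^ 2 * (δ ^ 4 * τ ^ 2) * 1
      ≤ 8 * (1 + A) ^ 2 * (δ ^ 4 * τ ^ 2) * (12 * νl) := by
    gcongr
    linarith
  have h3 : 0 ≤ (1 + A) ^ 2 * νl * (δ ^ 4 * τ ^ 2) := by
    have : 0 ≤ νl := by linarith
    positivity
  linarith

end BanditMLSM

open BanditMLSM in
theorem theorem3p3 :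
    ∃ C : ℝ, 0 < C ∧
      ∀ (d : ℕ), 1 ≤ d →
      ∀ (a : Fin d → ℝ) (D L₁ ν : ℝ) (K : Set (Vec d)) (Φ : Vec d → ℝ),
        IsCompact K → Convex ℝ K → (0 : Vec d) ∈ K → K ⊆ Metric.closedBall 0 D → K ⊆ box a →
        IsSelfConcordantBarrier K ν Φ →
      ∀ (T : ℕ), 2 ≤ T →
      ∀ (f : ℕ → Vec d → ℝ), (∀ t < T, IsMDSReward (box a) L₁ (f t)) →
      ∀ (L : ℕ) (η : ℝ),
        L = ⌈(d : ℝ) ^ (-(4 / 3) : ℝ) * (T : ℝ) ^ (1 / 3 : ℝ)⌉₊ →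
        η = (d : ℝ) ^ (-(8 / 3) : ℝ) * (T : ℝ) ^ (-(1 / 3) : ℝ) →
      ∀ (Ω : Type*) [MeasurableSpace Ω] (P : Measure Ω) [IsProbabilityMeasure P]
        (c : ℕ → Ω → Coins d L),
        (∀ q, Measurable (c q)) → (∀ q, P.map (c q) = coinLaw d L) → iIndepFun c P →
        (∀ᵐ ω ∂P, ∀ t < T, BanditMLSM.action K Φ η f (fun q => c q ω) t ∈ box a) ∧
        (∀ t < T, Integrable (fun ω => f t (BanditMLSM.action K Φ η f (fun q => c q ω) t)) P) ∧
        ∃ R : ℝ,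
          IsExpectedRegret P K (1 - 1 / Real.exp 1) T f
            (fun t ω => BanditMLSM.action K Φ η f (fun q => c q ω) t) R ∧
          R ≤ C * (1 + L₁ * D) ^ 2 * ν * (d : ℝ) ^ (4 / 3 : ℝ) * (T : ℝ) ^ (2 / 3 : ℝ) *
            Real.log T := by
  refine ⟨400, by norm_num, ?_⟩
  intro d hd a D L₁ ν K Φ hK _ h0 hKD hKa hΦ T hT f hf L η hLdef hηdef Ω _ P _ c hc hlaw hind
  have hd1 : (1 : ℝ) ≤ d := by exact_mod_cast hd
  have hT2 : (2 : ℝ) ≤ T := by exact_mod_cast hT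
  have hd0 : (0 : ℝ) ≤ d := by linarith
  have hT0 : (0 : ℝ) ≤ T := by linarith
  set δ : ℝ := (d : ℝ) ^ (1 / 3 : ℝ) with hδdef
  set τ : ℝ := (T : ℝ) ^ (1 / 3 : ℝ) with hτdef
  have hδ : 1 ≤ δ := Real.one_le_rpow hd1 (by norm_num)
  have hδ0 : 0 < δ := by linarith
  have hτ : 0 < τ := Real.rpow_pos_of_pos (by linarith) _
  have hpow : ∀ (b : ℝ), 0 ≤ b → ∀ n : ℕ, b ^ ((n : ℝ) / 3) = (b ^ (1 / 3 : ℝ)) ^ n := by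
    intro b hb n
    rw [← Real.rpow_natCast, ← Real.rpow_mul hb]
    ring_nf
  have hd3 : (d : ℝ) = δ ^ 3 := by
    have := hpow d hd0 3
    norm_num at this
    exact this
  have hT3 : (T : ℝ) = τ ^ 3 := by
    have := hpow T hT0 3
    norm_num at this
    exact this
  have hd43 : (d : ℝ) ^ (4 / 3 : ℝ) = δ ^ 4 := hpow d hd0 4
  have hT23 : (T : ℝ) ^ (2 / 3 : ℝ) = τ ^ 2 := hpow T hT0 2
  have hη : η = 1 / (δ ^ 8 * τ) := by
    have := hpow d hd0 8
    norm_num only [Nat.cast_ofNat] at this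
    rw [hηdef, Real.rpow_neg hd0, Real.rpow_neg hT0, this, ← hδdef, ← hτdef, one_div, mul_inv]
  have hLr : L = ⌈τ / δ ^ 4⌉₊ := by
    rw [hLdef, Real.rpow_neg hd0, hd43, inv_mul_eq_div]
  have hLpos : 0 < L := by
    rw [hLr, Nat.ceil_pos]
    positivity
  have hL0 : NeZero L := ⟨hLpos.ne'⟩
  have hD : 0 ≤ D := by simpa using hKD h0
  have hL₁ : 0 ≤ L₁ := by
    obtain ⟨x, hx⟩ := hΦ.interior_nonempty
    have hxa := lt_of_mem_interior_box (interior_mono hKa hx) ⟨0, hd⟩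
    have hxb := hKa (interior_subset hx)
    have h1 := (abs_nonneg _).trans ((hf 0 (by omega)).lipschitz
      (x + (a ⟨0, hd⟩ - x ⟨0, hd⟩) • baseVec ⟨0, hd⟩) (fun j => by
        by_cases hj : j = ⟨0, hd⟩
        · subst hj
          simpa using (hxb ⟨0, hd⟩).1.trans hxa.le
        · simpa [hj] using hxb j) x hxb)
    rw [add_sub_cancel_left] at h1
    refine nonneg_of_mul_nonneg_left h1 (norm_pos_iff.2 (smul_ne_zero (sub_pos.2 hxa).ne' ?_))
    simp [baseVec]
  have hA : 0 ≤ L₁ * D := mul_nonneg hL₁ hD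
  have hint : ∀ t < T, Integrable (fun ω => f t (action K Φ η f (fun q => c q ω) t)) P :=
    fun t ht => integrable_reward_action hd hΦ hK hKD hKa h0 hL₁ hf hc hlaw ht
  refine ⟨?_, hint, ?_⟩
  · filter_upwards [ae_forall_typicalCoins hd hc hlaw] with ω hω t _
    exact action_mem_box hΦ hK hKD hKa hω t
  -- The regret is a continuous function of the comparator, so its maximum is attained.
  have hcont : ContinuousOn (regretAgainst P (1 - 1 / Real.exp 1) T f
      (fun t ω => action K Φ η f (fun q => c q ω) t)) K := by
    refine ContinuousOn.congr (f := fun x => ∑ t ∈ Finset.range T, ((1 - 1 / Real.exp 1) * f t x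
      - ∫ ω, f t (action K Φ η f (fun q => c q ω) t) ∂P)) ?_
      fun x _ => regretAgainst_eq hd hΦ hK hKD hKa h0 hL₁ hf hc hlaw _ x
    refine continuousOn_finsetSum _ fun t ht => ?_
    have := (hf t (Finset.mem_range.1 ht)).continuous
    fun_prop
  obtain ⟨x, hx, hmax⟩ := hK.exists_isMaxOn ⟨0, h0⟩ hcont
  refine ⟨_, ⟨Set.mem_image_of_mem _ hx, ?_⟩, ?_⟩
  · rintro _ ⟨y, hy, rfl⟩
    exact hmax hy
  have hlogT : 1 / 2 ≤ Real.log T := by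
    have h1 := Real.log_two_gt_d9
    have h2 := Real.log_le_log (by norm_num) hT2
    linarith
  have hν := hΦ.one_div_six_le hK hd
  have hνl : 1 / 12 ≤ ν * Real.log T := by nlinarith
  have e : 400 * (1 + L₁ * D) ^ 2 * ν * (d : ℝ) ^ (4 / 3 : ℝ) * (T : ℝ) ^ (2 / 3 : ℝ) *
      Real.log T = 400 * (1 + L₁ * D) ^ 2 * (ν * Real.log T) * (δ ^ 4 * τ ^ 2) := by
    rw [hd43, hT23]
    ring
  rw [e]
  by_cases htriv : τ ≤ δ ^ 4 ∨ τ ≤ 8 * (L₁ * D)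
  · refine le_trans ?_ (trivial_bound hδ hA hνl htriv)
    rw [← hT3]
    exact regretAgainst_le_trivial hd hΦ hK hKD hKa h0 hL₁ hf hc hlaw hx
  · rw [not_or, not_le, not_le] at htriv
    have hηb : η * (4 * d ^ 2 * (L₁ * D)) ≤ 1 / 2 := by
      have e2 : η * (4 * d ^ 2 * (L₁ * D)) = 4 * (L₁ * D) / (δ ^ 2 * τ) := by
        rw [hη, hd3]
        field_simp
      rw [e2, div_le_iff₀ (by positivity)]
      have : 1 * τ ≤ δ ^ 2 * τ := by
        gcongr
        exact one_le_pow₀ hδ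
      linarith [htriv.2]
    have hη0 : 0 < η := by rw [hη]; positivity
    refine (regretAgainst_le hd (by omega) hη0 hΦ hK hKD hKa h0 hL₁ hf hc hlaw hind hηb hx).trans ?_
    rw [hη, hd3]
    refine parameter_bound hδ hA hνl htriv.1.le ?_ (Nat.cast_nonneg _) ?_ ?_
    · rw [hLr]
      exact (Nat.ceil_lt_add_one (by positivity)).le
    · rw [← hT3]
      exact_mod_cast Nat.mul_div_le T L
    · rw [hLr]
      exact Nat.le_ceil _
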